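/- Let $m \ge 1$ be an integer and let $R=\mathcal R_{3,m}$ be a finite commutative chain ring (a finite commutative ring with unity whose ideals are totally ordered by inclusion) with maximal ideal $\langle u\rangle$ of nilpotency index $e=3$ (that is, $u^3=0\neq u^2$) and with residue field $R/\langle u\rangle$ of order $2^m$. Suppose that $2\in\langle u^{\kappa}\rangle\setminus\langle u^{\kappa+1}\rangle$ with $\kappa=2$. A linear code of length $n$ over $R$ is an $R$-submodule $\mathcal C$ of $R^n$; it is self-orthogonal if $\sum_{i=1}^n v_iw_i=0$ for all $v,w\in\mathcal C$. It is of type $\{\lambda_1,\lambda_2,\lambda_3\}$ if, after a permutation of the coordinates, it has a generator matrix (a matrix whose rows form a minimal generating set) of the form $$\begin{bmatrix} I_{\lambda_1} & A_{1,1} & A_{1,2} & A_{1,3}\\ 0 & uI_{\lambda_2} & uA_{2,2} & uA_{2,3}\\ 0&0&u^2I_{\lambda_3}&u^2A_{3,3}\end{bmatrix},$$ with matrices $A_{i,j}$ over $R$ and with columns grouped into blocks of sizes $\lambda_1,\lambda_2,\lambda_3,n-\lambda_1-\lambda_2-\lambda_3$. Let $\mathscr M_3(n;\lambda_1,\lambda_2,\lambda_3)$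 be the number of self-orthogonal codes of length $n$ and type $\{\lambda_1,\lambda_2,\lambda_3\}$ over $R$. Let $n\ge 1$ and let $\lambda_1,\lambda_2,\lambda_3$ be non-negative integers such that $2\lambda_1+2\lambda_2\le n$ and $2\lambda_1+\lambda_2+\lambda_3\le n$. Put $\Lambda_1=\lambda_1$, $\Lambda_2=\lambda_1+\lambda_2$ and $\Lambda_3=\lambda_1+\lambda_2+\lambda_3$. Then $$\mathscr M_3(n;\lambda_1,\lambda_2,\lambda_3)=\widehat{\mathcal S}(n;\Lambda_2)\,(2^m)^{\lambda_3\lambda_1+(\Lambda_1+\Lambda_2)(n-\Lambda_3-\Lambda_1)+\Lambda_1^2}\begin{bmatrix}\Lambda_2\\ \lambda_1\end{bmatrix}_{2^m}\begin{bmatrix}\lambda_3+n-\Lambda_3-\Lambda_1\\ \lambda_3\end{bmatrix}_{2^m},$$ where $\begin{bmatrix}N\\k\end{bmatrix}_q=\prod_{i=0}^{k-1}\frac{q^{N-i}-1}{q^{i+1}-1}$ is the Gaussian binomial coefficient and $$\widehat{\mathcal S}(n;\Lambda_2)=\begin{cases}\displaystyle\prod_{i=0}^{\Lambda_2-1}\frac{2^{m(n-1-2i)}-1}{2^{m(i+1)}-1}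 & \text{if } n \text{ is odd};\\[3mm] \displaystyle\frac{2^{m(n-\Lambda_2)}-1}{2^{m\Lambda_2}-1}\prod_{i=0}^{\Lambda_2-2}\frac{2^{m(n-2-2i)}-1}{2^{m(i+1)}-1} & \text{if } \Lambda_2\neq 0 \text{ and } n \text{ is even};\\[3mm] 1 & \text{if } \Lambda_2=0 \text{ and } n \text{ is even}.\end{cases}$$ -/

import Mathlib

/-- `R` is a finite commutative chain ring (its ideals are totally ordered by inclusion) whose
maximal ideal is `⟨u⟩`, of nilpotency index `e`, with residue field of order `2 ^ m`, and such that
`2 ∈ ⟨u ^ κ⟩ \ ⟨u ^ (κ + 1)⟩`. -/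
structure IsEvenChainRing (R : Type*) [CommRing R] (e m κ : ℕ) (u : R) : Prop where
  finite : Finite R
  ideals_chain : ∀ I J : Ideal R, I ≤ J ∨ J ≤ I
  isMaximal : (Ideal.span {u}).IsMaximal
  pow_eq_zero : u ^ e = 0
  pow_ne_zero : ∀ i < e, u ^ i ≠ 0
  card_residue : Nat.card (R ⧸ Ideal.span {u}) = 2 ^ m
  two_mem : (2 : R) ∈ Ideal.span {u ^ κ}
  two_notMem : (2 : R) ∉ Ideal.span {u ^ (κ + 1)}

namespace LinearCode

variable {R : Type*} [CommRing R]

/-- The dual, for the Euclidean bilinear form `v ⬝ᵥ w = ∑ i, v i * w i`, of a linear code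
(a submodule of the module of tuples). -/
def dual {ι : Type*} [Fintype ι] (C : Submodule R (ι → R)) : Submodule R (ι → R) where
  carrier := {w | ∀ v ∈ C, v ⬝ᵥ w = 0}
  add_mem' := fun ha hb v hv => by rw [dotProduct_add, ha v hv, hb v hv, add_zero]
  zero_mem' := fun v _ => dotProduct_zero v
  smul_mem' := fun c w hw v hv => by rw [dotProduct_smul, hw v hv, smul_zero]

/-- A code is self-orthogonal when it is contained in its dual. -/
def IsSelfOrthogonal {ι : Type*} [Fintype ι] (C : Submodule R (ι → R)) : Prop :=
  C ≤ dual C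

/-- The rows of `G` form a minimal generating set of the code `C`. -/
def IsGeneratorMatrix {ρ ι : Type*} (G : Matrix ρ ι R) (C : Submodule R (ι → R)) : Prop :=
  Submodule.span R (Set.range G.row) = C ∧
    ∀ r : ρ, Submodule.span R (G.row '' {r}ᶜ) ≠ C

/-- `C'` is obtained from `C` by moving the coordinate at position `i` to position `σ i`, for some
bijection `σ` of the coordinate positions. -/
def PermEquivalent {ι ι' : Type*} (C : Submodule R (ι → R)) (C' : Submodule R (ι' → R)) : Prop :=
  ∃ σ : ι ≃ ι', C' = C.map (LinearEquiv.funCongrLeft R R σ.symm).toLinearMap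

/-- Standard form of a generator matrix. The rows come in blocks of sizes `l 0, …, l (e - 1)`, the
columns in blocks of the same sizes followed by one more block of size `d`. The `i`-th block row
(`i = 0, …, e - 1`) is `[0 ⋯ 0  uⁱ·I  uⁱ·A ⋯ uⁱ·A]`, with `uⁱ·I` in the `i`-th block column. -/
structure IsStandardForm (u : R) {e : ℕ} (l : Fin e → ℕ) {d : ℕ}
    (G : Matrix (Σ i : Fin e, Fin (l i)) ((Σ i : Fin e, Fin (l i)) ⊕ Fin d) R) : Prop where
  left : ∀ (i j : Fin e) (a : Fin (l i)) (b : Fin (l j)), j < i → G ⟨i, a⟩ (Sum.inl ⟨j, b⟩) = 0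
  pivot : ∀ (i : Fin e) (a b : Fin (l i)),
    G ⟨i, a⟩ (Sum.inl ⟨i, b⟩) = if a = b then u ^ (i : ℕ) else 0
  right : ∀ (i j : Fin e) (a : Fin (l i)) (b : Fin (l j)), i < j →
    ∃ x : R, G ⟨i, a⟩ (Sum.inl ⟨j, b⟩) = u ^ (i : ℕ) * x
  last : ∀ (i : Fin e) (a : Fin (l i)) (c : Fin d),
    ∃ x : R, G ⟨i, a⟩ (Sum.inr c) = u ^ (i : ℕ) * x

/-- A code of length `n` has type `{l 0, …, l (e - 1)}` when it is permutation equivalent to a code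
with a generator matrix in standard form, with blocks of these sizes. -/
def HasType (u : R) {e : ℕ} (l : Fin e → ℕ) {n : ℕ} (C : Submodule R (Fin n → R)) : Prop :=
  ∃ (G : Matrix (Σ i : Fin e, Fin (l i)) ((Σ i : Fin e, Fin (l i)) ⊕ Fin (n - ∑ i, l i)) R)
    (C' : Submodule R ((Σ i : Fin e, Fin (l i)) ⊕ Fin (n - ∑ i, l i) → R)),
    IsStandardForm u l G ∧ IsGeneratorMatrix G C' ∧ PermEquivalent C' C

/-- The number of self-orthogonal codes of length `n` and type `{l 0, …, l (e - 1)}` over `R`. -/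
noncomputable def numSelfOrthogonal (u : R) (n : ℕ) {e : ℕ} (l : Fin e → ℕ) : ℕ :=
  Set.ncard {C : Submodule R (Fin n → R) | IsSelfOrthogonal C ∧ HasType u l C}

/-- The Gaussian binomial coefficient `[N choose k]_q`. -/
def gaussBinom (q N k : ℕ) : ℚ :=
  ∏ i ∈ Finset.range k, ((q : ℚ) ^ (N - i) - 1) / ((q : ℚ) ^ (i + 1) - 1)

/-- The factor `Ŝ(n; d)`, for `q = 2 ^ m`. When `2 * d ≤ n`, no subtraction in an exponent
truncates. -/
def sHat (q n d : ℕ) : ℚ :=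
  if Odd n then
    ∏ i ∈ Finset.range d, ((q : ℚ) ^ (n - 1 - 2 * i) - 1) / ((q : ℚ) ^ (i + 1) - 1)
  else if d = 0 then 1
  else ((q : ℚ) ^ (n - d) - 1) / ((q : ℚ) ^ d - 1) *
    ∏ i ∈ Finset.range (d - 1), ((q : ℚ) ^ (n - 2 - 2 * i) - 1) / ((q : ℚ) ^ (i + 1) - 1)

end LinearCode

/-!
The codes are counted by counting bases of a kind. Let `F` be the residue field, `q` its order, and
`N = l₁ + l₂ + l₃`; row `s` of a generator matrix in standard form is `u ^ k s` times a vector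
`x s`, where `k s` is `0`, `1` or `2` according to the block (`rowDegree`). A *frame* of a code `C` is
a tuple `x` of `N` vectors with linearly independent residues such that the vectors `u ^ k s • x s`
generate `C` (`frameCode`). Gaussian elimination shows that `C` has type `{l₁, l₂, l₃}` if and only if
it has a frame (`IsResidueMap.hasType_iff`). Therefore the number of self-orthogonal codes is the
number of frames of such codes divided by the number of frames of one code.

*Frames of one code.* The possible entries `x s` form the module of vectors `y` with
`u ^ k s • y ∈ C`, whose order is explicit, and their residues form a torsion code of `C`. So the
frames are the lifts of the linearly independent tuples adapted to the flag of torsion codes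
(`IsResidueMap.card_frames`).

*Frames of all self-orthogonal codes.* The condition on `x` is `u ^ (k s + k t) * (x s ⬝ᵥ x t) = 0`
for all `s` and `t`. Write `x = a + u b + u² c` with digits in `F`. The condition says, first, that
`a s ⬝ᵥ a t = 0` when `k s + k t ≤ 2`; given such an `a`, it becomes a system of linear equations for
`b`, and, given `b`, another one for `c` (`IsResidueMap.exists_linear_systems`). For `s = t` in the
first block the linear terms vanish because `2 ∈ ⟨u ^ 2⟩`, and what remains prescribes
`(1 ⬝ᵥ b s) ^ 2`, that is, the sum of the coordinates of `b s`. The equations are linearly independent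
even if the all-ones vector lies in the span of `a` (`linearIndependent_pairFunctional`), so the number
of lifts is the same for every `a` (`IsResidueMap.card_selfOrthogonal_frames`).

*Residue tuples.* The entries of the first two blocks of `a` form an isotropic tuple, and those of the
third block are orthogonal to the first block (`card_isResidueTuple`). Isotropic tuples are extended
one vector at a time inside the orthogonal complement of the previous ones and of the all-ones vector,
since `v ⬝ᵥ v = (1 ⬝ᵥ v) ^ 2` in characteristic two. In odd length the all-ones vector is anisotropic;
in even length one keeps track of whether it lies in the span. This produces the factor `sHat`
(`card_isIsotropic`).
-/

namespace LinearCode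

open Matrix

/-! ### The residue map and expansions in powers of `u` -/

/-- The preimage of a set under a surjective homomorphism is counted by the set and the kernel. -/
theorem card_subtype_comp_addMonoidHom {G H : Type*} [AddCommGroup G] [AddCommGroup H]
    (f : G →+ H) (hf : Function.Surjective f) (P : H → Prop) :
    Nat.card {g // P (f g)} = Nat.card {y // P y} * Nat.card f.ker := by
  rw [← Nat.card_prod]
  have hs := Function.surjInv_eq hf
  exact Nat.card_congr
    { toFun := fun g => (⟨f g.1, g.2⟩, ⟨g.1 - Function.surjInv hf (f g.1), by simp [hs]⟩)
      invFun := fun p => ⟨Function.surjInv hf p.1.1 + p.2.1, by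
        rw [map_add, hs, p.2.2, add_zero]; exact p.1.2⟩
      left_inv := fun g => by simp
      right_inv := fun p => by
        have hp : f p.2.1 = 0 := p.2.2
        ext <;> simp [hs, hp] }

theorem card_range_mul_card_ker {G H : Type*} [AddCommGroup G] [AddCommGroup H] (f : G →+ H) :
    Nat.card f.range * Nat.card f.ker = Nat.card G := by
  rw [← AddSubgroup.index_ker, mul_comm, AddSubgroup.card_mul_index]

/-- `π : R → F` is the residue map of a ring `R` whose ideals are the powers of `⟨u⟩`, with
`u ^ 3 = 0 ≠ u ^ 2`, and `2 ∈ ⟨u ^ 2⟩`. The residue field is an arbitrary field `F` rather than a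
quotient of `R`. -/
structure IsResidueMap {R F : Type*} [CommRing R] [Field F] (u : R) (π : R →+* F) : Prop where
  surjective : Function.Surjective π
  eq_zero_iff : ∀ r, π r = 0 ↔ u ∣ r
  cube : u ^ 3 = 0
  sq_ne_zero : u ^ 2 ≠ 0
  sq_dvd_two : u ^ 2 ∣ 2

namespace IsResidueMap

variable {R F : Type*} [CommRing R] [Field F] {u : R} {π : R →+* F}

theorem map_u (h : IsResidueMap u π) : π u = 0 := (h.eq_zero_iff u).2 dvd_rfl

theorem isUnit_of_map_ne_zero (h : IsResidueMap u π) {r : R} (hr : π r ≠ 0) : IsUnit r := by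
  obtain ⟨s, hs⟩ := h.surjective (π r)⁻¹
  have h1 : π (r * s - 1) = 0 := by
    rw [map_sub, map_mul, hs, map_one, mul_inv_cancel₀ hr, sub_self]
  obtain ⟨t, ht⟩ := (h.eq_zero_iff _).1 h1
  have hn : IsNilpotent (u * t) := ⟨3, by rw [mul_pow, h.cube, zero_mul]⟩
  have h2 : IsUnit (r * s) := by
    have := hn.isUnit_add_one
    rwa [← ht, sub_add_cancel] at this
  exact isUnit_of_mul_isUnit_left h2

theorem sq_mul_eq_zero_iff (h : IsResidueMap u π) (r : R) : u ^ 2 * r = 0 ↔ π r = 0 := by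
  constructor
  · intro hr
    by_contra hne
    exact h.sq_ne_zero ((h.isUnit_of_map_ne_zero hne).mul_left_eq_zero.1 hr)
  · intro hr
    obtain ⟨t, rfl⟩ := (h.eq_zero_iff r).1 hr
    rw [← mul_assoc, ← pow_succ, h.cube, zero_mul]

theorem u_mul_eq_zero_iff (h : IsResidueMap u π) (r : R) : u * r = 0 ↔ u ^ 2 ∣ r := by
  constructor
  · intro hr
    have h1 : π r = 0 := by
      rw [← h.sq_mul_eq_zero_iff, pow_two, mul_assoc, hr, mul_zero]
    obtain ⟨t, rfl⟩ := (h.eq_zero_iff r).1 h1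
    have h2 : π t = 0 := by rw [← h.sq_mul_eq_zero_iff, pow_two, mul_assoc, hr]
    obtain ⟨s, rfl⟩ := (h.eq_zero_iff t).1 h2
    exact ⟨s, by ring⟩
  · rintro ⟨t, rfl⟩
    rw [← mul_assoc, ← pow_succ', h.cube, zero_mul]

theorem pow_mul_eq_zero_iff (h : IsResidueMap u π) {i : ℕ} (hi : i ≤ 3) (r : R) :
    u ^ i * r = 0 ↔ u ^ (3 - i) ∣ r := by
  interval_cases i
  · simp [h.cube]
  · simpa using h.u_mul_eq_zero_iff r
  · rw [h.sq_mul_eq_zero_iff, h.eq_zero_iff]; simp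
  · simp [h.cube]

/-- Cancellation of a power of `u` in a divisibility. -/
theorem pow_dvd_of_pow_dvd_pow_mul (h : IsResidueMap u π) {i j : ℕ} (hij : i ≤ j) (hj : j ≤ 3)
    {r : R} (hr : u ^ j ∣ u ^ i * r) : u ^ (j - i) ∣ r := by
  obtain ⟨s, hs⟩ := hr
  have h1 : u ^ i * (r - u ^ (j - i) * s) = 0 := by
    rw [mul_sub, hs, ← mul_assoc, ← pow_add, Nat.add_sub_cancel' hij, sub_self]
  rw [h.pow_mul_eq_zero_iff (hij.trans hj)] at h1
  have h2 : u ^ (j - i) ∣ r - u ^ (j - i) * s := (pow_dvd_pow u (by omega)).trans h1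
  simpa using dvd_add h2 (Dvd.intro s rfl)

theorem two_mul_u (h : IsResidueMap u π) (r : R) : 2 * (u * r) = 0 := by
  obtain ⟨t, ht⟩ := h.sq_dvd_two
  rw [ht]
  linear_combination t * r * h.cube

theorem charP (h : IsResidueMap u π) : CharP F 2 := by
  refine CharTwo.of_one_ne_zero_of_two_eq_zero one_ne_zero ?_
  have : π 2 = 0 := (h.eq_zero_iff 2).2 ((dvd_pow_self u two_ne_zero).trans h.sq_dvd_two)
  rwa [map_ofNat] at this

/-- A set-theoretic section of the residue map. -/
noncomputable def lift (h : IsResidueMap u π) : F → R := Function.surjInv h.surjective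

@[simp] theorem map_lift (h : IsResidueMap u π) (a : F) : π (h.lift a) = a :=
  Function.surjInv_eq h.surjective a

/-- The element of `R` with prescribed digits in its expansion in powers of `u`. -/
noncomputable def ofDigits (h : IsResidueMap u π) (d : F × F × F) : R :=
  h.lift d.1 + u * h.lift d.2.1 + u ^ 2 * h.lift d.2.2

theorem ofDigits_bijective (h : IsResidueMap u π) : Function.Bijective h.ofDigits := by
  constructor
  · rintro ⟨a, b, c⟩ ⟨a', b', c'⟩ hd
    simp only [ofDigits] at hd
    have ha : a = a' := by
      have := congrArg π hd
      simpa [h.map_u] using this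
    subst ha
    have hb : u * (h.lift b + u * h.lift c - (h.lift b' + u * h.lift c')) = 0 := by
      linear_combination hd
    rw [h.u_mul_eq_zero_iff] at hb
    have hb' : b = b' := by
      have := (h.eq_zero_iff _).2 ((dvd_pow_self u two_ne_zero).trans hb)
      simpa [h.map_u, sub_eq_zero] using this
    subst hb'
    have hc : u ^ 2 * (h.lift c - h.lift c') = 0 := by linear_combination hd
    rw [h.sq_mul_eq_zero_iff, map_sub, map_lift, map_lift, sub_eq_zero] at hc
    rw [hc]
  · intro r
    have h1 : π (r - h.lift (π r)) = 0 := by simp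
    obtain ⟨s, hs⟩ := (h.eq_zero_iff _).1 h1
    have h2 : π (s - h.lift (π s)) = 0 := by simp
    obtain ⟨t, ht⟩ := (h.eq_zero_iff _).1 h2
    have h3 : π (t - h.lift (π t)) = 0 := by simp
    obtain ⟨w, hw⟩ := (h.eq_zero_iff _).1 h3
    refine ⟨(π r, π s, π t), ?_⟩
    simp only [ofDigits]
    linear_combination - hs - u * ht - u ^ 2 * hw - w * h.cube

/-- The ideal `⟨u ^ i⟩` has `|F| ^ (3 - i)` elements. -/
theorem card_pow_dvd (h : IsResidueMap u π) [Finite R] {i : ℕ} (hi : i ≤ 3) :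
    Nat.card {r : R // u ^ i ∣ r} = Nat.card F ^ (3 - i) := by
  have hR : Nat.card R = Nat.card F ^ 3 := by
    rw [← Nat.card_congr (Equiv.ofBijective _ h.ofDigits_bijective), Nat.card_prod, Nat.card_prod]
    ring
  have hF : Finite F := Finite.of_surjective π h.surjective
  have hpos : 0 < Nat.card F := Nat.card_pos
  have hmul : ∀ j ≤ 3, Nat.card {r : R // u ^ j ∣ r} * Nat.card {r : R // u ^ (3 - j) ∣ r}
      = Nat.card F ^ 3 := by
    intro j hj
    have h1 := card_range_mul_card_ker (AddMonoidHom.mulLeft (u ^ j))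
    rw [hR] at h1
    rw [← h1]
    congr 1
    · refine Nat.card_congr (Equiv.subtypeEquivRight fun r => ?_)
      simp [dvd_def, eq_comm]
    · refine Nat.card_congr (Equiv.subtypeEquivRight fun r => ?_)
      rw [AddMonoidHom.mem_ker, AddMonoidHom.coe_mulLeft, h.pow_mul_eq_zero_iff hj]
  have h1 : Nat.card {r : R // u ^ 1 ∣ r} = Nat.card F ^ 2 := by
    have h2 := card_range_mul_card_ker π.toAddMonoidHom
    rw [hR] at h2
    have h3 : Nat.card π.toAddMonoidHom.range = Nat.card F := by
      rw [AddMonoidHom.range_eq_top.2 h.surjective]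
      exact Nat.card_congr AddSubgroup.topEquiv.toEquiv
    have h4 : Nat.card π.toAddMonoidHom.ker = Nat.card {r : R // u ^ 1 ∣ r} := by
      refine Nat.card_congr (Equiv.subtypeEquivRight fun r => ?_)
      rw [AddMonoidHom.mem_ker, pow_one, ← h.eq_zero_iff]; rfl
    rw [h3, h4] at h2
    exact Nat.eq_of_mul_eq_mul_left hpos (by rw [h2]; ring)
  have h0 : Nat.card {r : R // u ^ 3 ∣ r} = 1 := by
    rw [h.cube]; simp
  interval_cases i
  · have := hmul 0 (by norm_num)
    rw [Nat.sub_zero, h0, mul_one] at this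
    exact this
  · exact h1
  · have := hmul 1 (by norm_num)
    rw [h1] at this
    refine Nat.eq_of_mul_eq_mul_left (pow_pos hpos 2) ?_
    rw [show (2:ℕ) = 3 - 1 by rfl, this]; simp [← pow_succ]
  · simpa using h0

end IsResidueMap

theorem _root_.IsEvenChainRing.isResidueMap {R : Type*} [CommRing R] {m : ℕ} {u : R}
    (hR : IsEvenChainRing R 3 m 2 u) [(Ideal.span {u}).IsMaximal] :
    let _ := Ideal.Quotient.field (Ideal.span {u})
    IsResidueMap u (Ideal.Quotient.mk (Ideal.span {u})) := by
  let _ := Ideal.Quotient.field (Ideal.span {u})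
  exact
  { surjective := Ideal.Quotient.mk_surjective
    eq_zero_iff := fun r => by rw [Ideal.Quotient.eq_zero_iff_mem, Ideal.mem_span_singleton]
    cube := hR.pow_eq_zero
    sq_ne_zero := hR.pow_ne_zero 2 (by norm_num)
    sq_dvd_two := Ideal.mem_span_singleton.1 hR.two_mem }

/-! ### Independent systems of linear equations -/

section LinearSystems

variable {F : Type*} [Field F] {V P : Type*} [AddCommGroup V] [Module F V] [Fintype P]

theorem surjective_pi_of_linearIndependent (f : P → V →ₗ[F] F) (hf : LinearIndependent F f) :
    Function.Surjective (LinearMap.pi f) := by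
  classical
  rw [← LinearMap.range_eq_top]
  by_contra hne
  obtain ⟨g, hg0, hg⟩ := Submodule.exists_le_ker_of_lt_top _ (lt_top_iff_ne_top.2 hne)
  have hg' : ∀ y, g y = ∑ p, y p * g (Pi.single p 1) := fun y => by
    conv_lhs => rw [LinearMap.pi_apply_eq_sum_univ g y]
    refine Finset.sum_congr rfl fun p _ => ?_
    rw [smul_eq_mul]
    congr 2
    ext j
    simp [Pi.single_apply, eq_comm]
  have h0 : ∑ p, g (Pi.single p 1) • f p = 0 := by
    ext v
    have : g (LinearMap.pi f v) = 0 := hg ⟨v, rfl⟩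
    rw [hg'] at this
    simpa [LinearMap.sum_apply, mul_comm] using this
  have h1 := Fintype.linearIndependent_iff.1 hf _ h0
  exact hg0 (LinearMap.ext fun y => by rw [hg']; simp [h1])

/-- An inhomogeneous system of independent linear equations has `|V| / |F| ^ r` solutions, where `r`
is the number of equations. -/
theorem card_solutions_mul [Finite V] (f : P → V →ₗ[F] F)
    (hf : LinearIndependent F f) (t : P → F) :
    Nat.card {v // ∀ p, f p v = t p} * Nat.card F ^ Fintype.card P = Nat.card V := by
  have hs := surjective_pi_of_linearIndependent f hf
  have h1 := card_subtype_comp_addMonoidHom (LinearMap.pi f).toAddMonoidHom hs (· = t)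
  have h2 := card_range_mul_card_ker (LinearMap.pi f).toAddMonoidHom
  have h3 : Nat.card (LinearMap.pi f).toAddMonoidHom.range = Nat.card F ^ Fintype.card P := by
    rw [AddMonoidHom.range_eq_top.2 hs, Nat.card_congr AddSubgroup.topEquiv.toEquiv,
      Nat.card_fun, Nat.card_eq_fintype_card (α := P)]
  have h4 : Nat.card {v // ∀ p, f p v = t p} =
      Nat.card {v // (LinearMap.pi f).toAddMonoidHom v = t} :=
    Nat.card_congr (Equiv.subtypeEquivRight fun v => by simp [funext_iff])
  rw [h3] at h2
  rw [h4, h1, ← h2]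
  simp [mul_comm]

theorem card_span_range_of_linearIndependent {S : Type*} [Finite S] {a : S → V}
    (ha : LinearIndependent F a) :
    Nat.card (Submodule.span F (Set.range a)) = Nat.card F ^ Nat.card S := by
  rw [Nat.card_congr (Module.Basis.span ha).equivFun.toEquiv, Nat.card_fun]

theorem card_span_of_linearIndependent {N : ℕ} {a : Fin N → V} (ha : LinearIndependent F a) :
    Nat.card (Submodule.span F (Set.range a)) = Nat.card F ^ N := by
  rw [card_span_range_of_linearIndependent ha, Nat.card_fin]

end LinearSystems

section Pairing

variable {F : Type*} [Field F] {ι : Type*} [Fintype ι]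

/-- The linear functional `w ↦ v ⬝ᵥ w`. -/
def dotFunctional (v : ι → F) : (ι → F) →ₗ[F] F := dotProductBilin F F v

@[simp] theorem dotFunctional_apply (v w : ι → F) : dotFunctional v w = v ⬝ᵥ w := rfl

theorem linearIndependent_dotFunctional {P : Type*} [Fintype P] {a : P → ι → F}
    (ha : LinearIndependent F a) : LinearIndependent F fun p => dotFunctional (a p) := by
  rw [Fintype.linearIndependent_iff] at ha ⊢
  intro g hg
  refine ha g (dotProduct_eq_zero _ fun w => ?_)
  have := LinearMap.congr_fun hg w
  simpa [LinearMap.sum_apply, sum_dotProduct] using this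

/-- The linear functional on tuples `b` of vectors attached to a pair `(s, t)` of indices. Off the
diagonal it is the first-order variation of `a s ⬝ᵥ a t` when `a` moves in the direction `b`; on the
diagonal, where that variation vanishes in characteristic two, it is the sum of the coordinates of
`b s`. -/
def pairFunctional {N : ℕ} (a : Fin N → ι → F) (p : Fin N × Fin N) :
    (Fin N → ι → F) →ₗ[F] F :=
  if p.1 = p.2 then dotFunctional 1 ∘ₗ LinearMap.proj p.1
  else dotFunctional (a p.1) ∘ₗ LinearMap.proj p.2 + dotFunctional (a p.2) ∘ₗ LinearMap.proj p.1

theorem pairFunctional_self {N : ℕ} (a : Fin N → ι → F) (s : Fin N) (b : Fin N → ι → F) :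
    pairFunctional a (s, s) b = 1 ⬝ᵥ b s := by
  simp [pairFunctional]

theorem pairFunctional_of_ne {N : ℕ} (a : Fin N → ι → F) {s t : Fin N} (h : s ≠ t)
    (b : Fin N → ι → F) : pairFunctional a (s, t) b = a s ⬝ᵥ b t + a t ⬝ᵥ b s := by
  simp [pairFunctional, h]

/-- A linear relation between the functionals amounts to relations
`∑ s, M s t • a s + r t • 1 = 0` with `M` symmetric of zero diagonal. If `r t ≠ 0`, the all-ones
vector is `∑ s, α s • a s` with `M s t = - r t * α s`, and the shape of `M` forces `α = 0`. -/
theorem linearIndependent_pairFunctional [Nonempty ι] {N : ℕ} {a : Fin N → ι → F}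
    (ha : LinearIndependent F a) :
    LinearIndependent F fun p : {p : Fin N × Fin N // p.1 ≤ p.2} => pairFunctional a p.1 := by
  classical
  rw [Fintype.linearIndependent_iff] at ha ⊢
  intro g hg
  set G : Fin N → Fin N → F := fun s t => if h : s ≤ t then g ⟨(s, t), h⟩ else 0 with hG
  have hsum : ∀ b : Fin N → ι → F, ∑ s, ∑ t, G s t * pairFunctional a (s, t) b = 0 := by
    intro b
    have h1 := LinearMap.congr_fun hg b
    rw [LinearMap.sum_apply, LinearMap.zero_apply] at h1
    rw [← Fintype.sum_prod_type', ← h1]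
    refine (Finset.sum_filter_of_ne (p := fun p : Fin N × Fin N => p.1 ≤ p.2) ?_).symm.trans
      ((Finset.sum_subtype _ (by simp) _).trans (Finset.sum_congr rfl fun p _ => ?_))
    · intro p _ hp
      by_contra hlt
      simp [hG, hlt] at hp
    · have hp : p.1.1 ≤ p.1.2 := p.2
      simp [hG, hp]
  set M : Fin N → Fin N → F := fun s t => if s = t then 0 else G s t + G t s with hM
  have hMsymm : ∀ s t, M s t = M t s := fun s t => by
    simp only [hM, eq_comm (a := s), add_comm (G s t)]
  have hrel : ∀ t, ∑ s, M s t • a s + G t t • (1 : ι → F) = 0 := by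
    intro t
    refine dotProduct_eq_zero _ fun w => ?_
    rw [← hsum (Pi.single t w)]
    have hterm : ∀ s s', G s s' * pairFunctional a (s, s') (Pi.single t w) =
        (if s' = t then (if s = t then G t t * (1 ⬝ᵥ w) else G s t * (a s ⬝ᵥ w)) else 0) +
        (if s = t then (if s' = t then 0 else G t s' * (a s' ⬝ᵥ w)) else 0) := by
      intro s s'
      by_cases h : s = s'
      · subst h
        rw [pairFunctional_self]
        by_cases hst : s = t
        · subst hst; simp
        · simp [hst]
      · rw [pairFunctional_of_ne a h]
        by_cases hst : s = t
        · subst hst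
          simp [Ne.symm h]
        · by_cases hst' : s' = t
          · subst hst'; simp [h]
          · simp [hst, hst']
    simp only [hterm, Finset.sum_add_distrib, Finset.sum_ite_eq', Finset.mem_univ, if_true]
    rw [add_dotProduct, sum_dotProduct, smul_dotProduct]
    have h2 : G t t • ((1 : ι → F) ⬝ᵥ w) = ∑ s, if s = t then G t t * (1 ⬝ᵥ w) else 0 := by
      simp
    rw [h2, ← Finset.sum_add_distrib]
    have h3 : ∀ c : Fin N → Fin N → F,
        ∑ s, ∑ s', (if s = t then c s s' else 0) = ∑ s', c t s' := by
      intro c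
      rw [Finset.sum_comm]
      simp
    rw [h3, ← Finset.sum_add_distrib]
    refine Finset.sum_congr rfl fun s _ => ?_
    by_cases h : s = t
    · simp [hM, h]
    · simp [hM, h, add_mul, smul_dotProduct]
  have hdiag : ∀ t, G t t = 0 := by
    intro t
    by_contra hr
    set α : Fin N → F := fun s => -(G t t)⁻¹ * M s t with hα
    have hone : ∑ s, α s • a s = 1 := by
      have h1 : ∑ s, M s t • a s = -(G t t • (1 : ι → F)) := eq_neg_of_add_eq_zero_left (hrel t)
      simp only [hα, mul_smul, ← Finset.smul_sum, h1]
      rw [neg_smul, smul_neg, neg_neg, smul_smul, inv_mul_cancel₀ hr, one_smul]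
    have hMα : ∀ s t', M s t' = - G t' t' * α s := by
      intro s t'
      have h1 : ∑ s, (M s t' + G t' t' * α s) • a s = 0 := by
        simp only [add_smul, Finset.sum_add_distrib, mul_smul, ← Finset.smul_sum, hone]
        exact hrel t'
      have h2 := ha _ h1 s
      linear_combination h2
    have h0 : α t = 0 := by
      have h1 := hMα t t
      simp only [hM, if_true] at h1
      simpa [hr] using h1.symm
    have hα0 : ∀ s, α s = 0 := by
      intro s
      have h1 := hMα s t
      rw [hMsymm, hMα t s, h0, mul_zero] at h1
      simpa [hr] using h1.symm
    simp only [hα0, zero_smul, Finset.sum_const_zero] at hone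
    exact one_ne_zero (congrFun hone (Classical.arbitrary ι)).symm
  have hM0 : ∀ s t, M s t = 0 := by
    intro s t
    have h1 := hrel t
    rw [hdiag t, zero_smul, add_zero] at h1
    exact ha _ h1 s
  rintro ⟨⟨s, t⟩, hst⟩
  have hst' : s ≤ t := hst
  by_cases h : s = t
  · subst h
    have := hdiag s
    simpa [hG] using this
  · have h1 := hM0 s t
    have h2 : ¬ t ≤ s := fun h' => h (le_antisymm hst' h')
    simpa [hM, hG, h, hst', h2] using h1

end Pairing

/-! ### Counting isotropic tuples -/

section TupleCounting

/-- Counting tuples by their initial segment: if the admissible last entries form the difference of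
two subspaces of constant orders, the count is multiplied by the difference of these orders. -/
theorem card_tuple_succ {F V : Type*} [Field F] [AddCommGroup V] [Module F V] [Finite V] {N : ℕ}
    {P : (Fin N → V) → Prop} {Q : (Fin (N + 1) → V) → Prop}
    (W U : (Fin N → V) → Submodule F V) (c d : ℕ)
    (hUW : ∀ a, P a → U a ≤ W a) (hW : ∀ a, P a → Nat.card (W a) = c)
    (hU : ∀ a, P a → Nat.card (U a) = d)
    (hQ : ∀ a x, Q (Fin.snoc a x) ↔ P a ∧ x ∈ W a ∧ x ∉ U a) :
    (Nat.card {a // Q a} : ℚ) = Nat.card {a // P a} * ((c : ℚ) - d) := by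
  classical
  have e : {a // Q a} ≃ Σ a : {a // P a}, {x // x ∈ W a ∧ x ∉ U a} :=
    { toFun := fun a => by
        have h := (hQ (Fin.init a.1) (a.1 (Fin.last N))).1 (by rw [Fin.snoc_init_self]; exact a.2)
        exact ⟨⟨Fin.init a.1, h.1⟩, ⟨a.1 (Fin.last N), h.2⟩⟩
      invFun := fun p => ⟨Fin.snoc p.1.1 p.2.1, (hQ _ _).2 ⟨p.1.2, p.2.2⟩⟩
      left_inv := fun a => by simp
      right_inv := fun p => by
        rcases p with ⟨⟨a, ha⟩, ⟨x, hx⟩⟩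
        have h1 : Fin.init (Fin.snoc a x : Fin (N + 1) → V) = a := Fin.init_snoc _ _
        have h2 : (Fin.snoc a x : Fin (N + 1) → V) (Fin.last N) = x := Fin.snoc_last _ _
        simp only
        congr 1
        · simp
        · congr! 1
          simp }
  have hcard : ∀ a : {a // P a}, (Nat.card {x // x ∈ W a ∧ x ∉ U a} : ℚ) = (c : ℚ) - d := by
    intro a
    have h1 : ((W a.1 : Set V) \ (U a.1 : Set V)).ncard + (U a.1 : Set V).ncard
        = (W a.1 : Set V).ncard := Set.ncard_sdiff_add_ncard_of_subset (hUW a.1 a.2)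
    rw [← Nat.card_coe_set_eq, ← Nat.card_coe_set_eq, ← Nat.card_coe_set_eq] at h1
    have h2 : Nat.card (W a.1 : Set V) = c := hW a.1 a.2
    have h3 : Nat.card (U a.1 : Set V) = d := hU a.1 a.2
    rw [h2, h3] at h1
    rw [eq_sub_iff_add_eq]
    exact_mod_cast h1
  have : Fintype {a // P a} := Fintype.ofFinite _
  rw [Nat.card_congr e, Nat.card_sigma]
  push_cast
  simp [hcard, mul_sub]

theorem card_subtype_add_card_subtype {α : Type*} [Finite α] (P Q : α → Prop) :
    Nat.card {a // P a} = Nat.card {a // P a ∧ Q a} + Nat.card {a // P a ∧ ¬ Q a} := by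
  have h := Set.ncard_inter_add_ncard_sdiff_eq_ncard {a | P a} {a | Q a}
  exact h.symm

end TupleCounting

section Isotropic

variable {F : Type*} [Field F] {ι : Type*} [Fintype ι]

/-- The vectors orthogonal to all entries of a tuple. -/
def orthogonal {N : ℕ} (a : Fin N → ι → F) : Submodule F (ι → F) :=
  LinearMap.ker (LinearMap.pi fun s => dotFunctional (a s))

theorem mem_orthogonal {N : ℕ} {a : Fin N → ι → F} {x : ι → F} :
    x ∈ orthogonal a ↔ ∀ s, a s ⬝ᵥ x = 0 := by
  simp [orthogonal, funext_iff]

theorem mem_orthogonal_cons {N : ℕ} {a : Fin N → ι → F} {v x : ι → F} :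
    x ∈ orthogonal (Fin.cons v a : Fin (N + 1) → ι → F) ↔ v ⬝ᵥ x = 0 ∧ ∀ s, a s ⬝ᵥ x = 0 := by
  simp [mem_orthogonal, Fin.forall_fin_succ]

theorem card_orthogonal [Finite F] {N : ℕ} {a : Fin N → ι → F} (ha : LinearIndependent F a) :
    Nat.card (orthogonal a) = Nat.card F ^ (Fintype.card ι - N) := by
  have hN : N ≤ Fintype.card ι := by simpa using ha.fintype_card_le_finrank
  have h1 := card_solutions_mul (fun s => dotFunctional (a s))
    (linearIndependent_dotFunctional ha) (fun _ => 0)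
  have h2 : Nat.card {v // ∀ p, dotFunctional (a p) v = 0} = Nat.card (orthogonal a) :=
    Nat.card_congr (Equiv.subtypeEquivRight fun v => mem_orthogonal.symm)
  rw [h2, Fintype.card_fin, Nat.card_fun, Nat.card_eq_fintype_card (α := ι)] at h1
  refine Nat.eq_of_mul_eq_mul_right (pow_pos (Nat.card_pos (α := F)) N) ?_
  rw [h1, ← pow_add, Nat.sub_add_cancel hN]

theorem dotProduct_self_eq_sq [CharP F 2] (x : ι → F) : x ⬝ᵥ x = (1 ⬝ᵥ x) ^ 2 := by
  rw [one_dotProduct, CharTwo.sum_sq]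
  simp [dotProduct, pow_two]

/-- A tuple spanning, with linearly independent entries, a self-orthogonal code over a field. -/
def IsIsotropic {N : ℕ} (a : Fin N → ι → F) : Prop :=
  LinearIndependent F a ∧ ∀ s t, a s ⬝ᵥ a t = 0

theorem IsIsotropic.one_dotProduct [CharP F 2] {N : ℕ} {a : Fin N → ι → F} (ha : IsIsotropic a)
    (s : Fin N) : 1 ⬝ᵥ a s = 0 := by
  have h := ha.2 s s
  rw [dotProduct_self_eq_sq] at h
  exact pow_eq_zero_iff two_ne_zero |>.1 h

theorem IsIsotropic.span_le [CharP F 2] {N : ℕ} {a : Fin N → ι → F} (ha : IsIsotropic a) :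
    Submodule.span F (Set.range a) ≤ orthogonal (Fin.cons 1 a : Fin (N + 1) → ι → F) := by
  rw [Submodule.span_le]
  rintro _ ⟨s, rfl⟩
  exact mem_orthogonal_cons.2 ⟨ha.one_dotProduct s, fun t => ha.2 t s⟩

theorem forall_snoc_dotProduct_eq_zero_iff {N : ℕ} (a : Fin N → ι → F) (x : ι → F) :
    (∀ s t, (Fin.snoc a x : Fin (N + 1) → ι → F) s ⬝ᵥ
      (Fin.snoc a x : Fin (N + 1) → ι → F) t = 0) ↔
      (∀ s t, a s ⬝ᵥ a t = 0) ∧ (∀ s, a s ⬝ᵥ x = 0) ∧ x ⬝ᵥ x = 0 := by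
  simp only [Fin.forall_fin_succ', Fin.snoc_castSucc, Fin.snoc_last]
  constructor
  · rintro ⟨h1, h2, h3⟩
    exact ⟨fun s => (h1 s).1, fun s => (h1 s).2, h3⟩
  · rintro ⟨h1, h2, h3⟩
    exact ⟨fun s => ⟨h1 s, h2 s⟩, fun s => by rw [dotProduct_comm]; exact h2 s, h3⟩

theorem isIsotropic_snoc_iff [CharP F 2] {N : ℕ} (a : Fin N → ι → F) (x : ι → F) :
    IsIsotropic (Fin.snoc a x : Fin (N + 1) → ι → F) ↔
      IsIsotropic a ∧ x ∈ orthogonal (Fin.cons 1 a : Fin (N + 1) → ι → F) ∧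
        x ∉ Submodule.span F (Set.range a) := by
  rw [IsIsotropic, linearIndependent_finSnoc, forall_snoc_dotProduct_eq_zero_iff,
    mem_orthogonal_cons, dotProduct_self_eq_sq, pow_eq_zero_iff two_ne_zero, IsIsotropic]
  tauto

theorem card_isIsotropic_zero :
    Nat.card {a : Fin 0 → ι → F // IsIsotropic a} = 1 := by
  have h : ∀ a : Fin 0 → ι → F, IsIsotropic a := fun a =>
    ⟨linearIndependent_empty_type, fun s => s.elim0⟩
  rw [Nat.card_congr (Equiv.subtypeUnivEquiv h)]
  simp

theorem one_dotProduct_one : (1 : ι → F) ⬝ᵥ 1 = (Fintype.card ι : F) := by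
  simp

variable [Finite F]

/-- In odd length the all-ones vector is anisotropic, so it lies outside every isotropic span. -/
theorem card_isIsotropic_odd [CharP F 2] (hι : Odd (Fintype.card ι)) (N : ℕ)
    (hN : N ≤ Fintype.card ι) :
    (Nat.card {a : Fin N → ι → F // IsIsotropic a} : ℚ) =
      ∏ k ∈ Finset.range N, ((Nat.card F : ℚ) ^ (Fintype.card ι - 1 - k) - (Nat.card F : ℚ) ^ k) := by
  induction N with
  | zero => simp [card_isIsotropic_zero]
  | succ N ih =>
    rw [Finset.prod_range_succ, ← ih (by omega)]
    have hone : ∀ a : Fin N → ι → F, IsIsotropic a →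
        LinearIndependent F (Fin.cons 1 a : Fin (N + 1) → ι → F) := by
      intro a ha
      refine linearIndependent_finCons.2 ⟨ha.1, fun hmem => ?_⟩
      have h1 := (mem_orthogonal_cons.1 (ha.span_le hmem)).1
      rw [one_dotProduct_one, CharP.cast_eq_zero_iff F 2] at h1
      exact (Nat.not_even_iff_odd.2 hι) (even_iff_two_dvd.2 h1)
    have := card_tuple_succ (P := fun a : Fin N → ι → F => IsIsotropic a)
      (Q := fun a : Fin (N + 1) → ι → F => IsIsotropic a)
      (fun a => orthogonal (Fin.cons 1 a : Fin (N + 1) → ι → F))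
      (fun a => Submodule.span F (Set.range a))
      (Nat.card F ^ (Fintype.card ι - (N + 1))) (Nat.card F ^ N)
      (fun a ha => ha.span_le) (fun a ha => card_orthogonal (hone a ha))
      (fun a ha => card_span_of_linearIndependent ha.1) (fun a x => isIsotropic_snoc_iff a x)
    rw [this]
    push_cast
    rw [Nat.sub_sub, add_comm 1 N]

/-- In even length, isotropic tuples whose span does not contain the all-ones vector. -/
theorem card_isIsotropic_and_one_notMem [CharP F 2] (hι : Even (Fintype.card ι))
    (hpos : 0 < Fintype.card ι) (N : ℕ) (hN : N ≤ Fintype.card ι) :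
    (Nat.card {a : Fin N → ι → F // IsIsotropic a ∧ 1 ∉ Submodule.span F (Set.range a)} : ℚ) =
      ∏ k ∈ Finset.range N,
        ((Nat.card F : ℚ) ^ (Fintype.card ι - 1 - k) - (Nat.card F : ℚ) ^ (k + 1)) := by
  have hιF : (Fintype.card ι : F) = 0 := by
    rw [CharP.cast_eq_zero_iff F 2]; exact even_iff_two_dvd.1 hι
  have : Nonempty ι := Fintype.card_pos_iff.1 hpos
  induction N with
  | zero =>
    have h : ∀ a : Fin 0 → ι → F, IsIsotropic a ∧ 1 ∉ Submodule.span F (Set.range a) := fun a =>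
      ⟨⟨linearIndependent_empty_type, fun s => s.elim0⟩, by
        rw [Set.range_eq_empty, Submodule.span_empty, Submodule.mem_bot]; exact one_ne_zero⟩
    rw [Nat.card_congr (Equiv.subtypeUnivEquiv h)]
    simp
  | succ N ih =>
    rw [Finset.prod_range_succ, ← ih (by omega)]
    have hLI : ∀ a : Fin N → ι → F, IsIsotropic a ∧ 1 ∉ Submodule.span F (Set.range a) →
        LinearIndependent F (Fin.cons 1 a : Fin (N + 1) → ι → F) :=
      fun a ha => linearIndependent_finCons.2 ⟨ha.1.1, ha.2⟩
    have := card_tuple_succ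
      (P := fun a : Fin N → ι → F => IsIsotropic a ∧ 1 ∉ Submodule.span F (Set.range a))
      (Q := fun a : Fin (N + 1) → ι → F => IsIsotropic a ∧ 1 ∉ Submodule.span F (Set.range a))
      (fun a => orthogonal (Fin.cons 1 a : Fin (N + 1) → ι → F))
      (fun a => Submodule.span F (Set.range (Fin.cons 1 a : Fin (N + 1) → ι → F)))
      (Nat.card F ^ (Fintype.card ι - (N + 1))) (Nat.card F ^ (N + 1)) ?_
      (fun a ha => card_orthogonal (hLI a ha))
      (fun a ha => card_span_of_linearIndependent (hLI a ha)) ?_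
    · rw [this]
      push_cast
      rw [Nat.sub_sub, add_comm 1 N]
    · rintro a ⟨ha, -⟩
      rw [Fin.range_cons, Submodule.span_insert]
      refine sup_le ?_ ha.span_le
      rw [Submodule.span_singleton_le_iff_mem, mem_orthogonal_cons]
      refine ⟨by rw [one_dotProduct_one, hιF], fun s => ?_⟩
      rw [dotProduct_comm]; exact ha.one_dotProduct s
    · intro a x
      have h1 : LinearIndependent F (Fin.snoc a x : Fin (N + 1) → ι → F) ∧
          1 ∉ Submodule.span F (Set.range (Fin.snoc a x : Fin (N + 1) → ι → F)) ↔
          (LinearIndependent F a ∧ 1 ∉ Submodule.span F (Set.range a)) ∧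
          x ∉ Submodule.span F (Set.range (Fin.cons 1 a : Fin (N + 1) → ι → F)) := by
        rw [← linearIndependent_finCons, Fin.cons_snoc_eq_snoc_cons, linearIndependent_finSnoc,
          linearIndependent_finCons]
      have h2 : IsIsotropic (Fin.snoc a x : Fin (N + 1) → ι → F) ↔
          LinearIndependent F (Fin.snoc a x : Fin (N + 1) → ι → F) ∧ (∀ s t, a s ⬝ᵥ a t = 0) ∧
            x ∈ orthogonal (Fin.cons 1 a : Fin (N + 1) → ι → F) := by
        rw [IsIsotropic, forall_snoc_dotProduct_eq_zero_iff, mem_orthogonal_cons,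
          dotProduct_self_eq_sq, pow_eq_zero_iff two_ne_zero]
        tauto
      rw [h2, IsIsotropic]
      tauto

/-- Splitting according to whether the all-ones vector lies in the span of the first `N` entries
gives a recursion, which this product solves. -/
theorem card_isIsotropic_even [CharP F 2] (hι : Even (Fintype.card ι)) (N : ℕ)
    (hN : N + 1 ≤ Fintype.card ι) :
    (Nat.card {a : Fin (N + 1) → ι → F // IsIsotropic a} : ℚ) =
      ((Nat.card F : ℚ) ^ (Fintype.card ι - 1 - N) - 1) * ∏ k ∈ Finset.range N,
        ((Nat.card F : ℚ) ^ (Fintype.card ι - 1 - k) - (Nat.card F : ℚ) ^ (k + 1)) := by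
  have hsplit : ∀ N : ℕ, N + 1 ≤ Fintype.card ι →
      (Nat.card {a : Fin (N + 1) → ι → F // IsIsotropic a} : ℚ) =
      Nat.card {a : Fin N → ι → F // IsIsotropic a ∧ 1 ∉ Submodule.span F (Set.range a)} *
        ((Nat.card F : ℚ) ^ (Fintype.card ι - 1 - N) - (Nat.card F : ℚ) ^ N) +
      (Nat.card {a : Fin N → ι → F // IsIsotropic a} -
        Nat.card {a : Fin N → ι → F // IsIsotropic a ∧ 1 ∉ Submodule.span F (Set.range a)}) *
        ((Nat.card F : ℚ) ^ (Fintype.card ι - N) - (Nat.card F : ℚ) ^ N) := by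
    intro N hN
    have h1 := card_tuple_succ
      (P := fun a : Fin N → ι → F => IsIsotropic a ∧ 1 ∉ Submodule.span F (Set.range a))
      (Q := fun a : Fin (N + 1) → ι → F => IsIsotropic a ∧
        1 ∉ Submodule.span F (Set.range (Fin.init a)))
      (fun a => orthogonal (Fin.cons 1 a : Fin (N + 1) → ι → F))
      (fun a => Submodule.span F (Set.range a))
      (Nat.card F ^ (Fintype.card ι - (N + 1))) (Nat.card F ^ N)
      (fun a ha => ha.1.span_le)
      (fun a ha => card_orthogonal (linearIndependent_finCons.2 ⟨ha.1.1, ha.2⟩))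
      (fun a ha => card_span_of_linearIndependent ha.1.1)
      (fun a x => by rw [isIsotropic_snoc_iff, Fin.init_snoc]; tauto)
    have h2 := card_tuple_succ
      (P := fun a : Fin N → ι → F => IsIsotropic a ∧ ¬ 1 ∉ Submodule.span F (Set.range a))
      (Q := fun a : Fin (N + 1) → ι → F => IsIsotropic a ∧
        ¬ 1 ∉ Submodule.span F (Set.range (Fin.init a)))
      (fun a => orthogonal (Fin.cons 1 a : Fin (N + 1) → ι → F))
      (fun a => Submodule.span F (Set.range a))
      (Nat.card F ^ (Fintype.card ι - N)) (Nat.card F ^ N)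
      (fun a ha => ha.1.span_le)
      (fun a ha => by
        rw [← card_orthogonal ha.1.1]
        congr 2
        -- Orthogonality to the all-ones vector is implied, as it lies in the span.
        ext x
        rw [mem_orthogonal_cons, mem_orthogonal, and_iff_right_iff_imp]
        intro hx
        have h3 : Submodule.span F (Set.range a) ≤ LinearMap.ker (dotFunctional x) := by
          rw [Submodule.span_le]
          rintro _ ⟨s, rfl⟩
          simpa [dotProduct_comm] using hx s
        have h4 := h3 (not_not.1 ha.2)
        rw [LinearMap.mem_ker, dotFunctional_apply, dotProduct_comm] at h4
        exact h4)
      (fun a ha => card_span_of_linearIndependent ha.1.1)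
      (fun a x => by rw [isIsotropic_snoc_iff, Fin.init_snoc]; tauto)
    have h3 := card_subtype_add_card_subtype
      (fun a : Fin (N + 1) → ι → F => IsIsotropic a)
      (fun a => 1 ∉ Submodule.span F (Set.range (Fin.init a)))
    have h4 := card_subtype_add_card_subtype
      (fun a : Fin N → ι → F => IsIsotropic a)
      (fun a => 1 ∉ Submodule.span F (Set.range a))
    rw [h3]
    push_cast
    rw [h1, h2, h4]
    push_cast
    rw [Nat.sub_sub, add_comm 1 N]
    ring
  induction N with
  | zero =>
    rw [hsplit 0 hN, card_isIsotropic_and_one_notMem hι (by omega) 0 (by omega),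
      card_isIsotropic_zero]
    simp
  | succ N ih =>
    rw [hsplit (N + 1) hN, ih (by omega),
      card_isIsotropic_and_one_notMem hι (by omega) (N + 1) (by omega), Finset.prod_range_succ]
    rw [show Fintype.card ι - 1 - N = Fintype.card ι - 1 - (N + 1) + 1 by omega,
      show Fintype.card ι - (N + 1) = Fintype.card ι - 1 - (N + 1) + 1 by omega]
    ring

end Isotropic

/-! ### Adapted tuples, residue tuples and closed forms -/

section Flags

variable {F : Type*} [Field F]

/-- Linearly independent tuples adapted to an increasing sequence of subspaces. -/
theorem card_linearIndependent_mem {V : Type*} [AddCommGroup V] [Module F V] [Finite V]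
    (T : ℕ → Submodule F V) (hT : Monotone T) (N : ℕ) :
    (Nat.card {a : Fin N → V // LinearIndependent F a ∧ ∀ s : Fin N, a s ∈ T s} : ℚ) =
      ∏ j ∈ Finset.range N, ((Nat.card (T j) : ℚ) - (Nat.card F : ℚ) ^ j) := by
  induction N with
  | zero =>
    have h : ∀ a : Fin 0 → V, LinearIndependent F a ∧ ∀ s : Fin 0, a s ∈ T s := fun a =>
      ⟨linearIndependent_empty_type, fun s => s.elim0⟩
    rw [Nat.card_congr (Equiv.subtypeUnivEquiv h)]
    simp
  | succ N ih =>
    rw [Finset.prod_range_succ, ← ih]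
    have := card_tuple_succ
      (P := fun a : Fin N → V => LinearIndependent F a ∧ ∀ s : Fin N, a s ∈ T s)
      (Q := fun a : Fin (N + 1) → V => LinearIndependent F a ∧ ∀ s : Fin (N + 1), a s ∈ T s)
      (fun _ => T N) (fun a => Submodule.span F (Set.range a)) (Nat.card (T N)) (Nat.card F ^ N)
      ?_ (fun _ _ => rfl) (fun a ha => card_span_of_linearIndependent ha.1) ?_
    · rw [this]
      push_cast
      rfl
    · rintro a ⟨-, ha⟩
      rw [Submodule.span_le]
      rintro _ ⟨s, rfl⟩
      exact hT s.2.le (ha s)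
    · intro a x
      rw [linearIndependent_finSnoc, Fin.forall_fin_succ']
      simp only [Fin.snoc_castSucc, Fin.snoc_last, Fin.val_castSucc, Fin.val_last]
      tauto

end Flags

/-- The exponent of `u` in the `j`-th row of a generator matrix in standard form whose blocks have
sizes `l₁`, `l₂` and `l₃`. -/
def rowDegree (l₁ l₂ j : ℕ) : ℕ := if j < l₁ then 0 else if j < l₁ + l₂ then 1 else 2

theorem rowDegree_mono (l₁ l₂ : ℕ) : Monotone (rowDegree l₁ l₂) := by
  intro i j hij
  unfold rowDegree
  split_ifs <;> omega

theorem rowDegree_le_two (l₁ l₂ j : ℕ) : rowDegree l₁ l₂ j ≤ 2 := by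
  unfold rowDegree
  split_ifs <;> omega

theorem rowDegree_eq_zero_iff {l₁ l₂ j : ℕ} : rowDegree l₁ l₂ j = 0 ↔ j < l₁ := by
  unfold rowDegree
  by_cases h1 : j < l₁
  · simp [h1]
  · by_cases h2 : j < l₁ + l₂ <;> simp [h1, h2]

theorem rowDegree_le_one_iff {l₁ l₂ j : ℕ} : rowDegree l₁ l₂ j ≤ 1 ↔ j < l₁ + l₂ := by
  unfold rowDegree
  by_cases h1 : j < l₁
  · simp only [h1, if_true]; omega
  · by_cases h2 : j < l₁ + l₂ <;> simp [h1, h2]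

section Residues

variable {F : Type*} [Field F] {ι : Type*} [Fintype ι]

/-- The tuples that occur as residues of the rows, divided by their powers of `u`, of a generator
matrix of a self-orthogonal code. -/
def IsResidueTuple (l₁ l₂ : ℕ) {N : ℕ} (a : Fin N → ι → F) : Prop :=
  LinearIndependent F a ∧
    ∀ s t : Fin N, rowDegree l₁ l₂ s + rowDegree l₁ l₂ t ≤ 2 → a s ⬝ᵥ a t = 0

theorem isResidueTuple_iff_isIsotropic {l₁ l₂ N : ℕ} (hN : N ≤ l₁ + l₂) (a : Fin N → ι → F) :
    IsResidueTuple l₁ l₂ a ↔ IsIsotropic a := by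
  have h : ∀ s : Fin N, rowDegree l₁ l₂ s ≤ 1 := fun s =>
    rowDegree_le_one_iff.2 (by omega)
  exact and_congr_right fun _ =>
    ⟨fun h1 s t => h1 s t (add_le_add (h s) (h t)), fun h1 s t _ => h1 s t⟩

/-- Each vector of the third block only has to be orthogonal to the first block. -/
theorem card_isResidueTuple [Finite F] (l₁ l₂ l₃ : ℕ) :
    (Nat.card {a : Fin (l₁ + l₂ + l₃) → ι → F // IsResidueTuple l₁ l₂ a} : ℚ) =
      Nat.card {a : Fin (l₁ + l₂) → ι → F // IsIsotropic a} *
        ∏ j ∈ Finset.range l₃,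
          ((Nat.card F : ℚ) ^ (Fintype.card ι - l₁) - (Nat.card F : ℚ) ^ (l₁ + l₂ + j)) := by
  induction l₃ with
  | zero =>
    rw [Finset.range_zero, Finset.prod_empty, mul_one]
    exact congrArg _ (Nat.card_congr
      (Equiv.subtypeEquivRight fun a =>
        isResidueTuple_iff_isIsotropic (l₁ := l₁) (l₂ := l₂) le_rfl a))
  | succ l₃ ih =>
    rw [Finset.prod_range_succ, ← mul_assoc, ← ih]
    have hfirst : ∀ s : Fin l₁, (s : ℕ) < l₁ + l₂ + l₃ := fun s => by omega
    have := card_tuple_succ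
      (P := fun a : Fin (l₁ + l₂ + l₃) → ι → F => IsResidueTuple l₁ l₂ a)
      (Q := fun a : Fin (l₁ + l₂ + l₃ + 1) → ι → F => IsResidueTuple l₁ l₂ a)
      (fun a => orthogonal fun s : Fin l₁ => a ⟨s, hfirst s⟩)
      (fun a => Submodule.span F (Set.range a))
      (Nat.card F ^ (Fintype.card ι - l₁)) (Nat.card F ^ (l₁ + l₂ + l₃)) ?_ ?_
      (fun a ha => card_span_of_linearIndependent ha.1) ?_
    · rw [← add_assoc, this]
      push_cast
      rfl
    · rintro a ⟨-, ha⟩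
      rw [Submodule.span_le]
      rintro _ ⟨t, rfl⟩
      refine mem_orthogonal.2 fun s => ha _ _ ?_
      have h1 := rowDegree_le_two l₁ l₂ t
      have h2 : rowDegree l₁ l₂ s = 0 := rowDegree_eq_zero_iff.2 s.2
      simp only [h2]
      omega
    · rintro a ⟨ha, -⟩
      refine card_orthogonal (ha.comp _ fun s t hst => ?_)
      simpa [Fin.ext_iff] using hst
    · intro a x
      have hlast : rowDegree l₁ l₂ (l₁ + l₂ + l₃) = 2 := by
        unfold rowDegree
        split_ifs <;> omega
      simp only [IsResidueTuple, linearIndependent_finSnoc, Fin.forall_fin_succ', Fin.snoc_castSucc,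
        Fin.snoc_last, Fin.val_castSucc, Fin.val_last, hlast, mem_orthogonal]
      have h0 : ∀ s : Fin (l₁ + l₂ + l₃), rowDegree l₁ l₂ s + 2 ≤ 2 ↔ (s : ℕ) < l₁ := fun s => by
        rw [← rowDegree_eq_zero_iff (l₂ := l₂)]; omega
      have h0' : ∀ s : Fin (l₁ + l₂ + l₃), 2 + rowDegree l₁ l₂ s ≤ 2 ↔ (s : ℕ) < l₁ := fun s => by
        rw [add_comm, h0]
      simp only [h0, h0']
      constructor
      · rintro ⟨⟨h1, h2⟩, h3, h4, -⟩
        exact ⟨⟨h1, fun s => (h3 s).1⟩, fun s => (h3 ⟨s, hfirst s⟩).2 s.2, h2⟩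
      · rintro ⟨⟨h1, h3⟩, h4, h2⟩
        refine ⟨⟨h1, h2⟩, fun s => ⟨h3 s, fun hs => h4 ⟨s, hs⟩⟩, fun s hs => ?_, fun h => ?_⟩
        · rw [dotProduct_comm]; exact h4 ⟨s, hs⟩
        · omega

end Residues

section ClosedForms

theorem prod_pow_sub_pow (q : ℚ) (d : ℕ) :
    ∏ j ∈ Finset.range d, (q ^ d - q ^ j) =
      (∏ j ∈ Finset.range d, q ^ j) * ∏ i ∈ Finset.range d, (q ^ (i + 1) - 1) := by
  rw [← Finset.prod_range_reflect (fun i => q ^ (i + 1) - 1), ← Finset.prod_mul_distrib]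
  refine Finset.prod_congr rfl fun j hj => ?_
  have hj' := Finset.mem_range.1 hj
  rw [mul_sub, ← pow_add, mul_one]
  congr 2
  omega

theorem prod_pow_succ_sub_one_ne_zero {q : ℕ} (hq : 2 ≤ q) (d : ℕ) :
    ∏ i ∈ Finset.range d, ((q : ℚ) ^ (i + 1) - 1) ≠ 0 := by
  refine Finset.prod_ne_zero_iff.2 fun i _ => ?_
  have : (1 : ℚ) < (q : ℚ) ^ (i + 1) := one_lt_pow₀ (by exact_mod_cast hq) (by omega)
  linarith

theorem gaussBinom_mul_prod {q : ℕ} (hq : 2 ≤ q) {N k : ℕ} (hk : k ≤ N) :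
    gaussBinom q N k * ∏ j ∈ Finset.range k, ((q : ℚ) ^ k - (q : ℚ) ^ j) =
      ∏ j ∈ Finset.range k, ((q : ℚ) ^ N - (q : ℚ) ^ j) := by
  rw [prod_pow_sub_pow, gaussBinom, Finset.prod_div_distrib, mul_left_comm,
    div_mul_cancel₀ _ (prod_pow_succ_sub_one_ne_zero hq k), ← Finset.prod_mul_distrib]
  refine Finset.prod_congr rfl fun j hj => ?_
  have hj' := Finset.mem_range.1 hj
  rw [mul_sub, ← pow_add, mul_one]
  congr 2
  omega

variable {F : Type*} [Field F] {ι : Type*} [Fintype ι]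

/-- `sHat q n d` is the number of isotropic `d`-tuples divided by the number of bases of a
`d`-dimensional space. -/
theorem card_isIsotropic [Finite F] [CharP F 2] {n d : ℕ} (hn : Fintype.card ι = n)
    (hd : 2 * d ≤ n) :
    (Nat.card {a : Fin d → ι → F // IsIsotropic a} : ℚ) =
      sHat (Nat.card F) n d *
        ∏ j ∈ Finset.range d, ((Nat.card F : ℚ) ^ d - (Nat.card F : ℚ) ^ j) := by
  subst hn
  have hq : 2 ≤ Nat.card F := Finite.one_lt_card
  rw [prod_pow_sub_pow]
  generalize hqq : Nat.card F = q at *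
  rcases Nat.even_or_odd (Fintype.card ι) with he | ho
  · rw [sHat, if_neg (Nat.not_odd_iff_even.2 he)]
    rcases d with - | d
    · rw [card_isIsotropic_zero]; simp
    · rw [if_neg (by omega), card_isIsotropic_even he d (by omega), hqq, Nat.add_sub_cancel,
        Finset.prod_div_distrib, Finset.prod_range_succ (fun i => (q : ℚ) ^ (i + 1) - 1),
        Finset.prod_range_succ' (fun i => (q : ℚ) ^ i)]
      have h1 := prod_pow_succ_sub_one_ne_zero hq d
      have h2 : (q : ℚ) ^ (d + 1) - 1 ≠ 0 := by
        have h3 := prod_pow_succ_sub_one_ne_zero hq (d + 1)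
        rw [Finset.prod_range_succ] at h3
        exact right_ne_zero_of_mul h3
      have h4 : ∏ k ∈ Finset.range d, ((q : ℚ) ^ (Fintype.card ι - 1 - k) - (q : ℚ) ^ (k + 1)) =
          (∏ k ∈ Finset.range d, (q : ℚ) ^ (k + 1)) *
            ∏ k ∈ Finset.range d, ((q : ℚ) ^ (Fintype.card ι - 2 - 2 * k) - 1) := by
        rw [← Finset.prod_mul_distrib]
        refine Finset.prod_congr rfl fun k hk => ?_
        have hk' := Finset.mem_range.1 hk
        rw [mul_sub, ← pow_add, mul_one]
        congr 2
        omega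
      rw [h4, Nat.sub_sub, add_comm 1 d]
      field_simp
  · rw [sHat, if_pos ho, card_isIsotropic_odd ho d (by omega), hqq, Finset.prod_div_distrib,
      mul_left_comm, div_mul_cancel₀ _ (prod_pow_succ_sub_one_ne_zero hq d),
      ← Finset.prod_mul_distrib]
    refine Finset.prod_congr rfl fun k hk => ?_
    have hk' := Finset.mem_range.1 hk
    rw [mul_sub, ← pow_add, mul_one]
    congr 2
    omega

end ClosedForms

/-! ### Frames of codes and their number -/

section Frames

variable {R F : Type*} [CommRing R] [Field F] {u : R} {π : R →+* F}
variable {ι S : Type*} [Fintype S]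

/-- The code generated by the vectors `u ^ k s • x s`. The tuple `x` is called a frame of this code
when the residues of its entries are linearly independent. -/
def frameCode (u : R) (k : S → ℕ) (x : S → ι → R) : Submodule R (ι → R) :=
  Submodule.span R (Set.range fun s => u ^ k s • x s)

theorem mem_frameCode {k : S → ℕ} {x : S → ι → R} {y : ι → R} :
    y ∈ frameCode u k x ↔ ∃ d : S → R, (∀ s, u ^ k s ∣ d s) ∧ ∑ s, d s • x s = y := by
  rw [frameCode, Submodule.mem_span_range_iff_exists_fun]
  constructor
  · rintro ⟨c, rfl⟩
    exact ⟨fun s => c s * u ^ k s, fun s => dvd_mul_left _ _, by simp [mul_smul]⟩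
  · rintro ⟨d, hd, rfl⟩
    choose c hc using hd
    exact ⟨c, Finset.sum_congr rfl fun s _ => by rw [hc s, smul_smul, mul_comm]⟩

omit [Fintype S] in
theorem pow_smul_mem_frameCode (u : R) (k : S → ℕ) (x : S → ι → R) (s : S) :
    u ^ k s • x s ∈ frameCode u k x :=
  Submodule.subset_span ⟨s, rfl⟩

theorem map_comp_sum_smul (c : S → R) (x : S → ι → R) :
    (π ∘ ∑ s, c s • x s) = ∑ s, π (c s) • (π ∘ x s) := by
  ext j
  simp [Finset.sum_apply]

namespace IsResidueMap

/-- Linear independence of the residues passes to all the layers `⟨u ^ i⟩`. -/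
theorem pow_dvd_of_pow_dvd_sum_smul (h : IsResidueMap u π) {x : S → ι → R}
    (hx : LinearIndependent F fun s => π ∘ x s) {i : ℕ} (hi : i ≤ 3) {c : S → R}
    (hc : ∀ j, u ^ i ∣ (∑ s, c s • x s) j) (s : S) : u ^ i ∣ c s := by
  induction i generalizing c s with
  | zero => simp
  | succ i ih =>
    have h0 : ∀ s, π (c s) = 0 := by
      refine Fintype.linearIndependent_iff.1 hx _ ?_
      rw [← map_comp_sum_smul]
      ext j
      exact (h.eq_zero_iff _).2 ((dvd_pow_self u i.succ_ne_zero).trans (hc j))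
    choose c' hc' using fun s => (h.eq_zero_iff _).1 (h0 s)
    rw [hc' s, pow_succ']
    refine mul_dvd_mul_left u (ih (by omega) (fun j => ?_) s)
    have h1 : (∑ s, c s • x s) j = u ^ 1 * (∑ s, c' s • x s) j := by
      simp only [hc', Finset.sum_apply, Pi.smul_apply, smul_eq_mul, pow_one, Finset.mul_sum,
        mul_assoc]
    exact h.pow_dvd_of_pow_dvd_pow_mul (by omega) hi (h1 ▸ hc j)

theorem eq_zero_of_sum_smul_eq_zero (h : IsResidueMap u π) {x : S → ι → R}
    (hx : LinearIndependent F fun s => π ∘ x s) {c : S → R} (hc : ∑ s, c s • x s = 0) (s : S) :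
    c s = 0 := by
  have h1 := h.pow_dvd_of_pow_dvd_sum_smul hx le_rfl (c := c)
    (fun j => by rw [hc]; exact dvd_zero _) s
  rwa [h.cube, zero_dvd_iff] at h1

theorem card_frameCode_pow_dvd (h : IsResidueMap u π) [Finite R] {k : S → ℕ} (hk : ∀ s, k s ≤ 3)
    {x : S → ι → R} (hx : LinearIndependent F fun s => π ∘ x s) {i : ℕ} (hi : i ≤ 3) :
    Nat.card {y // y ∈ frameCode u k x ∧ ∀ j, u ^ i ∣ y j} =
      ∏ s, Nat.card F ^ (3 - max (k s) i) := by
  have h1 : ∀ s, Nat.card {d : R // u ^ max (k s) i ∣ d} = Nat.card F ^ (3 - max (k s) i) :=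
    fun s => h.card_pow_dvd (max_le (hk s) hi)
  simp only [← h1]
  rw [← Nat.card_pi]
  symm
  refine Nat.card_congr (Equiv.ofBijective (fun d => ⟨∑ s, (d s).1 • x s, ?_, ?_⟩) ⟨?_, ?_⟩)
  · exact mem_frameCode.2
      ⟨_, fun s => (pow_dvd_pow u (le_max_left _ _)).trans (d s).2, rfl⟩
  · intro j
    rw [Finset.sum_apply]
    exact Finset.dvd_sum fun s _ =>
      Dvd.dvd.mul_right ((pow_dvd_pow u (le_max_right _ _)).trans (d s).2) _
  · intro d d' hd
    ext s
    have h2 : ∑ s, ((d s).1 - (d' s).1) • x s = 0 := by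
      simp only [sub_smul, Finset.sum_sub_distrib, sub_eq_zero]
      exact congrArg Subtype.val hd
    exact sub_eq_zero.1 (h.eq_zero_of_sum_smul_eq_zero hx h2 s)
  · rintro ⟨y, hy, hyi⟩
    obtain ⟨d, hd, rfl⟩ := mem_frameCode.1 hy
    have h2 := fun s => h.pow_dvd_of_pow_dvd_sum_smul hx hi hyi s
    refine ⟨fun s => ⟨d s, ?_⟩, rfl⟩
    rcases le_total (k s) i with hle | hle
    · rw [max_eq_right hle]; exact h2 s
    · rw [max_eq_left hle]; exact hd s

theorem card_frameCode (h : IsResidueMap u π) [Finite R] {k : S → ℕ} (hk : ∀ s, k s ≤ 3)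
    {x : S → ι → R} (hx : LinearIndependent F fun s => π ∘ x s) :
    Nat.card (frameCode u k x) = ∏ s, Nat.card F ^ (3 - k s) := by
  have h1 := h.card_frameCode_pow_dvd hk hx (Nat.zero_le 3)
  simp only [zero_le, max_eq_left] at h1
  rw [← h1]
  exact Nat.card_congr (Equiv.subtypeEquivRight fun y => by simp)

/-- Two frames with the same exponents generate the same code as soon as one of the codes contains
the other, because the exponents determine the number of codewords. -/
theorem frameCode_eq_of_forall_mem (h : IsResidueMap u π) [Finite R] [Finite ι] {k : S → ℕ}
    (hk : ∀ s, k s ≤ 3) {x x' : S → ι → R} (hx : LinearIndependent F fun s => π ∘ x s)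
    (hx' : LinearIndependent F fun s => π ∘ x' s)
    (hmem : ∀ s, u ^ k s • x' s ∈ frameCode u k x) : frameCode u k x' = frameCode u k x := by
  refine SetLike.coe_injective (Set.eq_of_subset_of_ncard_le ?_ ?_ (Set.toFinite _))
  · exact Submodule.span_le.2 (by rintro _ ⟨s, rfl⟩; exact hmem s)
  · rw [← Nat.card_coe_set_eq, ← Nat.card_coe_set_eq]
    exact ((h.card_frameCode hk hx).trans (h.card_frameCode hk hx').symm).le

end IsResidueMap

/-- The vectors whose multiple by `u ^ i` belongs to a code. -/
def colonPow (u : R) (C : Submodule R (ι → R)) (i : ℕ) : Submodule R (ι → R) :=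
  C.comap (LinearMap.lsmul R (ι → R) (u ^ i))

theorem mem_colonPow {C : Submodule R (ι → R)} {i : ℕ} {y : ι → R} :
    y ∈ colonPow u C i ↔ u ^ i • y ∈ C := Iff.rfl

/-- The `i`-th torsion code of the code with frame `x`: it is spanned by the residues of the entries
of the frame with exponent at most `i`. -/
def torsionCode (π : R →+* F) (k : S → ℕ) (x : S → ι → R) (i : ℕ) : Submodule F (ι → F) :=
  Submodule.span F (Set.range fun s : {s // k s ≤ i} => π ∘ x s.1)

omit [Fintype S] in
theorem torsionCode_mono (k : S → ℕ) (x : S → ι → R) : Monotone (torsionCode π k x) := by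
  intro i j hij
  refine Submodule.span_mono ?_
  rintro _ ⟨s, rfl⟩
  exact ⟨⟨s.1, s.2.trans hij⟩, rfl⟩

theorem card_torsionCode {k : S → ℕ} {x : S → ι → R}
    (hx : LinearIndependent F fun s => π ∘ x s) (i : ℕ) :
    Nat.card (torsionCode π k x i) = Nat.card F ^ Nat.card {s // k s ≤ i} :=
  card_span_range_of_linearIndependent (hx.comp _ Subtype.val_injective)

namespace IsResidueMap

theorem map_comp_mem_torsionCode (h : IsResidueMap u π) {k : S → ℕ} (hk : ∀ s, k s ≤ 3)
    {x : S → ι → R} (hx : LinearIndependent F fun s => π ∘ x s) {i : ℕ} (hi : i ≤ 2)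
    {y : ι → R} (hy : y ∈ colonPow u (frameCode u k x) i) : π ∘ y ∈ torsionCode π k x i := by
  classical
  obtain ⟨d, hd, hdy⟩ := mem_frameCode.1 (mem_colonPow.1 hy)
  have h1 : ∀ s, u ^ i ∣ d s := h.pow_dvd_of_pow_dvd_sum_smul hx (by omega) fun j => by
    rw [hdy]; exact ⟨y j, rfl⟩
  choose e he using h1
  have h2 : π ∘ y = ∑ s, π (e s) • (π ∘ x s) := by
    rw [← map_comp_sum_smul]
    ext j
    have h3 : u ^ i * (y j - (∑ s, e s • x s) j) = 0 := by
      have h4 := congrFun hdy j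
      simp only [he, Finset.sum_apply, Pi.smul_apply, smul_eq_mul, mul_assoc, ← Finset.mul_sum]
        at h4 ⊢
      rw [mul_sub, h4, sub_self]
    rw [h.pow_mul_eq_zero_iff (by omega)] at h3
    have h5 := (h.eq_zero_iff _).2 ((dvd_pow_self u (by omega)).trans h3)
    rw [map_sub, sub_eq_zero] at h5
    exact h5
  rw [h2]
  refine Submodule.sum_mem _ fun s _ => ?_
  by_cases hs : k s ≤ i
  · exact Submodule.smul_mem _ _ (Submodule.subset_span ⟨⟨s, hs⟩, rfl⟩)
  · have h6 : u ^ (k s - i) ∣ e s :=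
      h.pow_dvd_of_pow_dvd_pow_mul (by omega) (hk s) (by rw [← he]; exact hd s)
    rw [(h.eq_zero_iff _).2 ((dvd_pow_self u (by omega)).trans h6), zero_smul]
    exact Submodule.zero_mem _

theorem exists_mem_colonPow_of_mem_torsionCode (h : IsResidueMap u π) {k : S → ℕ}
    {x : S → ι → R} {i : ℕ} {a : ι → F} (ha : a ∈ torsionCode π k x i) :
    ∃ y ∈ colonPow u (frameCode u k x) i, π ∘ y = a := by
  classical
  obtain ⟨c, rfl⟩ := (Submodule.mem_span_range_iff_exists_fun F).1 ha
  refine ⟨∑ s : {s // k s ≤ i}, h.lift (c s) • x s.1, ?_, ?_⟩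
  · refine Submodule.sum_mem _ fun s _ => Submodule.smul_mem _ _ (mem_colonPow.2 ?_)
    have h1 : u ^ i = u ^ (i - k s) * u ^ k s := by rw [← pow_add, Nat.sub_add_cancel s.2]
    rw [h1, mul_smul]
    exact Submodule.smul_mem _ _ (pow_smul_mem_frameCode u k x s.1)
  · rw [map_comp_sum_smul]
    simp

theorem card_colonPow (h : IsResidueMap u π) [Finite R] [Fintype ι] {k : S → ℕ}
    (hk : ∀ s, k s ≤ 3) {x : S → ι → R} (hx : LinearIndependent F fun s => π ∘ x s) {i : ℕ}
    (hi : i ≤ 3) :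
    Nat.card (colonPow u (frameCode u k x) i) =
      (∏ s, Nat.card F ^ (3 - max (k s) i)) * Nat.card F ^ (i * Fintype.card ι) := by
  let f : colonPow u (frameCode u k x) i →+ (ι → R) :=
    (LinearMap.lsmul R (ι → R) (u ^ i)).toAddMonoidHom.comp
      (colonPow u (frameCode u k x) i).subtype.toAddMonoidHom
  have hf : ∀ y, f y = u ^ i • y.1 := fun _ => rfl
  rw [← card_range_mul_card_ker f, ← h.card_frameCode_pow_dvd hk hx hi]
  congr 1
  · refine Nat.card_congr (Equiv.subtypeEquivRight fun z => ?_)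
    rw [AddMonoidHom.mem_range]
    constructor
    · rintro ⟨y, rfl⟩
      exact ⟨y.2, fun j => ⟨y.1 j, rfl⟩⟩
    · rintro ⟨hz, hzi⟩
      choose y hy using hzi
      have hzy : u ^ i • y = z := funext fun j => (hy j).symm
      exact ⟨⟨y, by rw [mem_colonPow, hzy]; exact hz⟩, hzy⟩
  · have h1 : Nat.card f.ker = Nat.card (ι → {r : R // u ^ (3 - i) ∣ r}) := by
      refine Nat.card_congr
        { toFun := fun y j => ⟨y.1.1 j, ?_⟩
          invFun := fun z => ⟨⟨fun j => (z j).1, ?_⟩, ?_⟩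
          left_inv := fun y => rfl
          right_inv := fun z => rfl }
      · rw [← h.pow_mul_eq_zero_iff hi]
        exact congrFun y.2 j
      · rw [mem_colonPow]
        convert Submodule.zero_mem _
        ext j
        exact (h.pow_mul_eq_zero_iff hi _).2 (z j).2
      · rw [AddMonoidHom.mem_ker, hf]
        ext j
        exact (h.pow_mul_eq_zero_iff hi _).2 (z j).2
    rw [h1, Nat.card_fun, h.card_pow_dvd (by omega), ← pow_mul, Nat.card_eq_fintype_card (α := ι),
      show 3 - (3 - i) = i by omega]

/-- The number of frames of a code that has one. A frame is a linearly independent tuple adapted to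
the torsion codes, together with a lift of each entry. -/
theorem card_frames (h : IsResidueMap u π) [Finite R] [Fintype ι] {N : ℕ} {k : ℕ → ℕ}
    (hmono : Monotone k) (hk : ∀ j, k j ≤ 2)
    {x₀ : Fin N → ι → R} (hx₀ : LinearIndependent F fun s => π ∘ x₀ s) :
    (Nat.card {x : Fin N → ι → R // (LinearIndependent F fun s => π ∘ x s) ∧
        frameCode u (fun s : Fin N => k s) x = frameCode u (fun s : Fin N => k s) x₀} : ℚ) *
      ∏ s : Fin N, Nat.card F ^ Nat.card {t : Fin N // k t ≤ k s} =
    (∏ j ∈ Finset.range N,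
        ((Nat.card F : ℚ) ^ Nat.card {t : Fin N // k t ≤ k j} - (Nat.card F : ℚ) ^ j)) *
      ∏ s : Fin N, ((∏ t : Fin N, Nat.card F ^ (3 - max (k t) (k s))) *
        Nat.card F ^ (k s * Fintype.card ι)) := by
  set κ : Fin N → ℕ := fun s => k s with hκ
  have hκ3 : ∀ s, κ s ≤ 3 := fun s => (hk s).trans (by norm_num)
  have hF : Finite F := Finite.of_surjective π h.surjective
  set Y : ℕ → Submodule R (ι → R) := colonPow u (frameCode u κ x₀) with hY
  set T : ℕ → Submodule F (ι → F) := torsionCode π κ x₀ with hT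
  let f : (∀ s : Fin N, Y (k s)) →+ (∀ s : Fin N, T (k s)) :=
    { toFun := fun y s => ⟨π ∘ (y s).1, h.map_comp_mem_torsionCode hκ3 hx₀ (hk s) (y s).2⟩
      map_zero' := by ext; simp
      map_add' := fun y z => by ext; simp }
  have hf : Function.Surjective f := by
    intro a
    choose y hy hya using fun s => h.exists_mem_colonPow_of_mem_torsionCode (a s).2
    exact ⟨fun s => ⟨y s, hy s⟩, funext fun s => Subtype.ext (hya s)⟩
  have h1 := card_subtype_comp_addMonoidHom f hf
    (fun a => LinearIndependent F fun s : Fin N => ((a s : T (k s)) : ι → F))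
  have h2 := card_range_mul_card_ker f
  rw [AddMonoidHom.range_eq_top.2 hf, Nat.card_congr AddSubgroup.topEquiv.toEquiv, Nat.card_pi,
    Nat.card_pi] at h2
  have h3 : Nat.card {x : Fin N → ι → R // (LinearIndependent F fun s => π ∘ x s) ∧
      frameCode u κ x = frameCode u κ x₀} =
      Nat.card {y : ∀ s : Fin N, Y (k s) //
        LinearIndependent F fun s : Fin N => ((f y s : T (k s)) : ι → F)} := by
    refine Nat.card_congr
      { toFun := fun x => ⟨fun s => ⟨x.1 s, ?_⟩, x.2.1⟩
        invFun := fun y => ⟨fun s => (y.1 s).1, y.2, ?_⟩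
        left_inv := fun _ => rfl
        right_inv := fun _ => rfl }
    · exact mem_colonPow.2 (x.2.2.le (pow_smul_mem_frameCode u κ x.1 s))
    · exact h.frameCode_eq_of_forall_mem hκ3 hx₀ y.2 fun s => (y.1 s).2
  have h4 : Nat.card {a : ∀ s : Fin N, T (k s) //
        LinearIndependent F fun s : Fin N => ((a s : T (k s)) : ι → F)} =
      Nat.card {a : Fin N → ι → F // LinearIndependent F a ∧ ∀ s : Fin N, a s ∈ T (k s)} :=
    Nat.card_congr
      { toFun := fun a => ⟨fun s => (a.1 s).1, a.2, fun s => (a.1 s).2⟩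
        invFun := fun a => ⟨fun s => ⟨a.1 s, a.2.2 s⟩, a.2.1⟩
        left_inv := fun _ => rfl
        right_inv := fun _ => rfl }
  have h5 := card_linearIndependent_mem (fun j => T (k j))
    ((torsionCode_mono κ x₀).comp hmono) N
  have hTcard : ∀ i, Nat.card (T i) = Nat.card F ^ Nat.card {t : Fin N // k t ≤ i} :=
    card_torsionCode hx₀
  have hYcard : ∀ s : Fin N, Nat.card (Y (k s)) =
      (∏ t : Fin N, Nat.card F ^ (3 - max (k t) (k s))) * Nat.card F ^ (k s * Fintype.card ι) :=
    fun s => h.card_colonPow hκ3 hx₀ (hκ3 s)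
  rw [h3, h1, h4]
  simp only [hTcard] at h2 h5
  simp only [hYcard] at h2
  have h2' := congrArg (Nat.cast : ℕ → ℚ) h2
  push_cast at h2' h5 ⊢
  rw [h5, ← h2']
  ring

end IsResidueMap

end Frames

/-! ### Standard forms and frames -/

section Pivots

variable {R F : Type*} [CommRing R] [Field F] {u : R} {π : R →+* F} {ι : Type*}

theorem linearIndependent_of_pivots {S : Type*} [Fintype S] [DecidableEq S] {k : S → ℕ}
    {a : S → ι → F} {p : S → ι}
    (hp : ∀ s t, k t ≤ k s → a s (p t) = if s = t then 1 else 0) : LinearIndependent F a := by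
  rw [Fintype.linearIndependent_iff]
  intro c hc
  have key : ∀ i, ∀ t, k t = i → c t = 0 := by
    intro i
    induction i using Nat.strong_induction_on with
    | _ i ih =>
      intro t ht
      have h1 := congrFun hc (p t)
      rw [Finset.sum_apply, Finset.sum_eq_single t] at h1
      · simpa [hp t t le_rfl] using h1
      · intro s _ hst
        by_cases hs : k t ≤ k s
        · simp [hp s t hs, hst]
        · simp [ih (k s) (by omega) s rfl]
      · simp
  exact fun t => key _ t rfl

/-- Pivot positions for a linearly independent tuple can be chosen such that, for every initial
segment of the tuple, its restriction to its own pivot positions is invertible. -/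
theorem exists_pivots {N : ℕ} {a : Fin N → ι → F} (ha : LinearIndependent F a) :
    ∃ p : Fin N → ι, ∀ L : Set (Fin N), IsLowerSet L → ∀ c : Fin N → F, (∀ s, s ∉ L → c s = 0) →
      (∀ t ∈ L, ∑ s, c s * a s (p t) = 0) → c = 0 := by
  induction N with
  | zero => exact ⟨fun s => s.elim0, fun _ _ c _ _ => funext fun s => s.elim0⟩
  | succ N ih =>
    obtain ⟨b, x, rfl⟩ : ∃ (b : Fin N → ι → F) (x : ι → F),
        a = (Fin.snoc b x : Fin (N + 1) → ι → F) :=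
      ⟨Fin.init a, a (Fin.last N), (Fin.snoc_init_self a).symm⟩
    obtain ⟨hb, hx⟩ := linearIndependent_finSnoc.1 ha
    obtain ⟨p, hp⟩ := ih hb
    -- Clear the entries of the last vector at the pivots found so far.
    have hsurj : ∃ d : Fin N → F, ∀ t, ∑ s, d s * b s (p t) = x (p t) := by
      let f : (Fin N → F) →ₗ[F] (Fin N → F) := Matrix.vecMulLinear (Matrix.of fun s t => b s (p t))
      have hf : Function.Injective f := by
        rw [← LinearMap.ker_eq_bot, LinearMap.ker_eq_bot']
        intro c hc
        exact hp Set.univ isLowerSet_univ c (fun s hs => absurd (Set.mem_univ s) hs)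
          fun t _ => congrFun hc t
      obtain ⟨d, hd⟩ := LinearMap.injective_iff_surjective.1 hf fun t => x (p t)
      exact ⟨d, fun t => congrFun hd t⟩
    obtain ⟨d, hd⟩ := hsurj
    obtain ⟨j, hj⟩ : ∃ j, x j - ∑ s, d s * b s j ≠ 0 := by
      by_contra! hall
      refine hx ((Submodule.mem_span_range_iff_exists_fun F).2 ⟨d, funext fun j => ?_⟩)
      rw [Finset.sum_apply]
      exact (sub_eq_zero.1 (hall j)).symm
    refine ⟨Fin.snoc p j, fun L hL c hcL hc => ?_⟩
    have hc0 : c (Fin.last N) = 0 ∧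
        ((fun s : Fin N => c s.castSucc + c (Fin.last N) * d s) = 0) := by
      by_cases hlast : Fin.last N ∈ L
      · have hall : ∀ t, t ∈ L := fun t => hL (Fin.le_last t) hlast
        have h1 : (fun s : Fin N => c s.castSucc + c (Fin.last N) * d s) = 0 := by
          refine hp Set.univ isLowerSet_univ _ (fun s hs => absurd (Set.mem_univ s) hs)
            fun t _ => ?_
          have h2 := hc t.castSucc (hall _)
          simp only [Fin.sum_univ_castSucc, Fin.snoc_castSucc, Fin.snoc_last] at h2
          simp only [add_mul, Finset.sum_add_distrib, mul_assoc, ← Finset.mul_sum, hd]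
          exact h2
        refine ⟨?_, h1⟩
        have h3 := hc (Fin.last N) hlast
        simp only [Fin.sum_univ_castSucc, Fin.snoc_castSucc, Fin.snoc_last] at h3
        have h4 : ∀ s : Fin N, c s.castSucc = - (c (Fin.last N) * d s) := fun s =>
          eq_neg_of_add_eq_zero_left (congrFun h1 s)
        simp only [h4] at h3
        have h5 : c (Fin.last N) * (x j - ∑ s, d s * b s j) = 0 := by
          rw [← h3, mul_sub, Finset.mul_sum]
          simp only [neg_mul, Finset.sum_neg_distrib, mul_assoc]
          ring
        exact (mul_eq_zero.1 h5).resolve_right hj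
      · have h0 := hcL _ hlast
        refine ⟨h0, ?_⟩
        simp only [h0, zero_mul, add_zero]
        refine hp (Fin.castSucc ⁻¹' L) (fun s t hts hs => hL (Fin.castSucc_le_castSucc_iff.2 hts) hs)
          _ (fun s hs => hcL _ hs) fun t ht => ?_
        have h2 := hc t.castSucc ht
        simp only [Fin.sum_univ_castSucc, Fin.snoc_castSucc, Fin.snoc_last, h0, zero_mul,
          add_zero] at h2
        exact h2
    funext t
    refine Fin.lastCases hc0.1 (fun s => ?_) t
    have h1 := congrFun hc0.2 s
    simpa [hc0.1] using h1

/-- Gaussian elimination within the initial segments of a tuple, over the ring. -/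
theorem IsResidueMap.exists_reduced_tuple (h : IsResidueMap u π) {N : ℕ} {k : Fin N → ℕ}
    (hk : Monotone k) {x : Fin N → ι → R} (hx : LinearIndependent F fun s => π ∘ x s) :
    ∃ (p : Fin N → ι) (y : Fin N → ι → R),
      (∀ s t, k t ≤ k s → y s (p t) = if s = t then 1 else 0) ∧
      ∀ s, ∃ d : Fin N → R, (∀ t, k s < k t → d t = 0) ∧ y s = ∑ t, d t • x t := by
  obtain ⟨p, hp⟩ := exists_pivots hx
  have key : ∀ s, ∃ d : Fin N → R, (∀ t, k s < k t → d t = 0) ∧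
      ∀ t, k t ≤ k s → (∑ r, d r • x r) (p t) = if s = t then 1 else 0 := by
    intro s
    let M : Matrix {t // k t ≤ k s} {t // k t ≤ k s} R := Matrix.of fun r t => x r.1 (p t.1)
    have hdet : π M.det ≠ 0 := by
      rw [RingHom.map_det]
      intro h0
      obtain ⟨v, hv, hvM⟩ := Matrix.exists_vecMul_eq_zero_iff.2 h0
      have h1 := hp {t | k t ≤ k s} (fun a b hba ha => (hk hba).trans ha)
        (fun t => if ht : k t ≤ k s then v ⟨t, ht⟩ else 0) (fun t ht => dif_neg ht) ?_
      · refine hv (funext fun t => ?_)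
        have h2 := congrFun h1 t.1
        simpa [t.2] using h2
      · intro t ht
        refine Eq.trans ?_ (congrFun hvM ⟨t, ht⟩)
        simp only [Matrix.vecMul, dotProduct]
        rw [← Finset.sum_filter_of_ne (p := fun r => k r ≤ k s),
          Finset.sum_subtype (p := fun r => k r ≤ k s) _ (by simp)]
        · refine Finset.sum_congr rfl fun r _ => ?_
          simp [r.2, M]
        · intro r _ hr
          by_contra hlt
          simp [hlt] at hr
    have hunit : IsUnit M.det := h.isUnit_of_map_ne_zero hdet
    let w : {t // k t ≤ k s} → R := Pi.single ⟨s, le_rfl⟩ 1 ᵥ* M⁻¹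
    have hw : w ᵥ* M = Pi.single ⟨s, le_rfl⟩ 1 := by
      rw [Matrix.vecMul_vecMul, Matrix.nonsing_inv_mul _ hunit, Matrix.vecMul_one]
    refine ⟨fun t => if ht : k t ≤ k s then w ⟨t, ht⟩ else 0, fun t ht => dif_neg (by omega),
      fun t ht => ?_⟩
    have h1 := congrFun hw ⟨t, ht⟩
    rw [Pi.single_apply] at h1
    simp only [Subtype.mk.injEq, eq_comm (a := t)] at h1
    rw [← h1]
    simp only [Matrix.vecMul, dotProduct, Finset.sum_apply, Pi.smul_apply, smul_eq_mul]
    rw [← Finset.sum_filter_of_ne (p := fun r => k r ≤ k s),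
      Finset.sum_subtype (p := fun r => k r ≤ k s) _ (by simp)]
    · refine Finset.sum_congr rfl fun r _ => ?_
      simp [r.2, M]
    · intro r _ hr
      by_contra hlt
      simp [hlt] at hr
  choose d hd0 hd using key
  exact ⟨p, fun s => ∑ t, d s t • x t, fun s t => hd s t, fun s => ⟨d s, hd0 s, rfl⟩⟩

end Pivots

section StandardForm

variable {R F : Type*} [CommRing R] [Field F] {u : R} {π : R →+* F} {ι S : Type*} [Fintype S]

/-- The generators `u ^ k s • x s` given by a frame form a minimal generating set. -/
theorem IsResidueMap.isGeneratorMatrix (h : IsResidueMap u π) {k : S → ℕ} (hk : ∀ s, k s ≤ 2)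
    {x : S → ι → R} (hx : LinearIndependent F fun s => π ∘ x s) :
    IsGeneratorMatrix (Matrix.of fun s => u ^ k s • x s) (frameCode u k x) := by
  classical
  refine ⟨rfl, fun r heq => ?_⟩
  have hmem : u ^ k r • x r ∈ Submodule.span R
      (Set.range (Function.update (fun s => u ^ k s • x s) r 0)) := by
    have h1 := pow_smul_mem_frameCode u k x r
    rw [← heq] at h1
    refine Submodule.span_mono ?_ h1
    rintro _ ⟨s, hs, rfl⟩
    exact ⟨s, Function.update_of_ne hs _ _⟩
  obtain ⟨c, hc⟩ := (Submodule.mem_span_range_iff_exists_fun R).1 hmem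
  have h2 : ∑ s, (if s = r then - u ^ k s else c s * u ^ k s) • x s = 0 := by
    rw [← Finset.add_sum_erase _ _ (Finset.mem_univ r)] at hc ⊢
    rw [if_pos rfl, neg_smul, ← hc, Function.update_self, smul_zero, zero_add, neg_add_eq_zero]
    refine Finset.sum_congr rfl fun s hs => ?_
    have hsr := Finset.ne_of_mem_erase hs
    rw [if_neg hsr, Function.update_of_ne hsr, mul_smul]
  have h3 := h.eq_zero_of_sum_smul_eq_zero hx h2 r
  rw [if_pos rfl, neg_eq_zero] at h3
  have h4 : u ^ 2 = u ^ k r * u ^ (2 - k r) := by rw [← pow_add, Nat.add_sub_cancel' (hk r)]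
  exact h.sq_ne_zero (by rw [h4, h3, zero_mul])

omit [Fintype S] in
theorem map_funCongrLeft_frameCode {ι' : Type*} (e : ι' ≃ ι) (k : S → ℕ) (x : S → ι → R) :
    (frameCode u k x).map (LinearEquiv.funCongrLeft R R e).toLinearMap =
      frameCode u k fun s => x s ∘ e := by
  rw [frameCode, Submodule.map_span, ← Set.range_comp]
  rfl

variable {l : Fin 3 → ℕ} {n : ℕ}

theorem exists_frame_of_hasType (π : R →+* F)
    {C : Submodule R (Fin n → R)} (hC : HasType u l C) :
    ∃ x : (Σ i : Fin 3, Fin (l i)) → Fin n → R, (LinearIndependent F fun s => π ∘ x s) ∧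
      frameCode u (fun s => (s.1 : ℕ)) x = C := by
  obtain ⟨G, C', hG, ⟨hspan, -⟩, σ, rfl⟩ := hC
  have hentry : ∀ s col, ∃ r : R, G s col = u ^ (s.1 : ℕ) * r ∧
      ∀ t, col = Sum.inl t → (t.1 : ℕ) ≤ s.1 → r = if s = t then 1 else 0 := by
    rintro ⟨i, a⟩ (⟨j, b⟩ | c)
    · rcases lt_trichotomy j i with hji | rfl | hij
      · refine ⟨0, by rw [hG.left i j a b hji, mul_zero], ?_⟩
        rintro t ht -
        obtain rfl := Sum.inl_injective ht
        rw [if_neg]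
        rintro hst
        exact hji.ne (congrArg Sigma.fst hst).symm
      · refine ⟨if a = b then 1 else 0, by rw [hG.pivot j a b]; simp, ?_⟩
        rintro t ht -
        obtain rfl := Sum.inl_injective ht
        simp
      · obtain ⟨r, hr⟩ := hG.right i j a b hij
        refine ⟨r, hr, ?_⟩
        rintro t ht hle
        obtain rfl := Sum.inl_injective ht
        exact absurd hij (not_lt.2 hle)
    · obtain ⟨r, hr⟩ := hG.last i a c
      exact ⟨r, hr, by rintro t ht; cases ht⟩
  choose x hGx hxp using hentry
  refine ⟨fun s => x s ∘ σ.symm, ?_, ?_⟩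
  · refine linearIndependent_of_pivots (k := fun s => (s.1 : ℕ)) (p := fun t => σ (Sum.inl t))
      fun s t hst => ?_
    simp only [Function.comp_apply, Equiv.symm_apply_apply, hxp s _ t rfl hst]
    split_ifs <;> simp
  · rw [← map_funCongrLeft_frameCode, ← hspan]
    have hrow : (fun s => u ^ (s.1 : ℕ) • x s) = G.row :=
      funext fun s => funext fun col => (hGx s col).symm
    rw [frameCode, hrow]

theorem IsResidueMap.hasType_of_frame (h : IsResidueMap u π) [Finite R]
    (e : (Σ i : Fin 3, Fin (l i)) ≃ Fin (∑ i, l i)) (hle : ∑ i, l i ≤ n)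
    {k : Fin (∑ i, l i) → ℕ} (hk : Monotone k) (hke : ∀ s, k (e s) = s.1)
    {x : Fin (∑ i, l i) → Fin n → R} (hx : LinearIndependent F fun s => π ∘ x s) :
    HasType u l (frameCode u k x) := by
  have hk2 : ∀ s, k s ≤ 2 := fun s => by
    obtain ⟨s, rfl⟩ := e.surjective s
    rw [hke]; omega
  have hnt : Nontrivial R := π.domain_nontrivial
  obtain ⟨p, y, hy, hyx⟩ := h.exists_reduced_tuple hk hx
  have hyLI : LinearIndependent F fun s => π ∘ y s := by
    refine linearIndependent_of_pivots (k := k) (p := p) fun s t hst => ?_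
    rw [Function.comp_apply, hy s t hst]
    split_ifs <;> simp
  have hcode : frameCode u k y = frameCode u k x := by
    refine h.frameCode_eq_of_forall_mem (fun s => (hk2 s).trans (by norm_num)) hx hyLI
      fun s => ?_
    obtain ⟨d, hd0, hd⟩ := hyx s
    rw [hd, Finset.smul_sum]
    refine Submodule.sum_mem _ fun t _ => ?_
    by_cases hst : k t ≤ k s
    · have h1 : u ^ k s = u ^ (k s - k t) * u ^ k t := by rw [← pow_add, Nat.sub_add_cancel hst]
      rw [smul_comm, h1, mul_smul]
      exact Submodule.smul_mem _ _ (Submodule.smul_mem _ _ (pow_smul_mem_frameCode u k x t))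
    · rw [hd0 t (by omega), zero_smul, smul_zero]
      exact Submodule.zero_mem _
  have hpinj : Function.Injective p := by
    have aux : ∀ s t, k t ≤ k s → p s = p t → s = t := by
      intro s t hst hpst
      have h1 := hy s t hst
      rw [← hpst, hy s s le_rfl, if_pos rfl] at h1
      by_contra hne
      rw [if_neg hne] at h1
      exact one_ne_zero h1
    intro s t hpst
    rcases le_total (k t) (k s) with hle' | hle'
    · exact aux s t hle' hpst
    · exact (aux t s hle' hpst.symm).symm
  obtain ⟨σ, hσ⟩ : ∃ σ : (Σ i : Fin 3, Fin (l i)) ⊕ Fin (n - ∑ i, l i) ≃ Fin n,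
      ∀ s, σ (Sum.inl s) = p (e s) := by
    classical
    rcases Nat.eq_zero_or_pos n with rfl | hn
    · have h0 : IsEmpty (Σ i : Fin 3, Fin (l i)) := by
        rw [← Fintype.card_eq_zero_iff, Fintype.card_congr e, Fintype.card_fin]; omega
      exact ⟨Fintype.equivOfCardEq (by simp), fun s => h0.elim s⟩
    · obtain ⟨g, hg⟩ := Finset.exists_equiv_extend_of_card_eq
        (α := (Σ i : Fin 3, Fin (l i)) ⊕ Fin (n - ∑ i, l i)) (t := (Finset.univ : Finset (Fin n)))
        (by rw [Fintype.card_sum, Fintype.card_congr e]; simp; omega)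
        (s := Finset.univ.filter fun c => c.isLeft)
        (f := Sum.elim (fun s => p (e s)) fun _ => ⟨0, hn⟩) (Finset.subset_univ _)
        (by
          rintro (s | s) hs (t | t) ht hst <;> simp at hs ht
          exact congrArg _ (e.injective (hpinj hst)))
      refine ⟨g.trans (Equiv.subtypeUnivEquiv fun _ => Finset.mem_univ _), fun s => ?_⟩
      exact hg (Sum.inl s) (by simp)
  have hzLI : LinearIndependent F fun s => π ∘ (y (e s) ∘ σ) := by
    refine linearIndependent_of_pivots (k := fun s => (s.1 : ℕ)) (p := Sum.inl) fun s t hst => ?_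
    simp only [Function.comp_apply, hσ]
    rw [hy _ _ (by rw [hke, hke]; exact hst)]
    simp only [e.injective.eq_iff]
    split_ifs <;> simp
  have hentry : ∀ s t : (Σ i : Fin 3, Fin (l i)), t.1 ≤ s.1 →
      y (e s) (σ (Sum.inl t)) = if s = t then 1 else 0 := by
    intro s t hst
    rw [hσ, hy _ _ (by rw [hke, hke]; exact hst)]
    simp only [e.injective.eq_iff]
  refine ⟨Matrix.of fun s => u ^ (s.1 : ℕ) • (y (e s) ∘ σ), _, ?_,
    h.isGeneratorMatrix (fun s => by omega) hzLI, σ, ?_⟩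
  · constructor
    · intro i j a b hji
      have h1 := hentry ⟨i, a⟩ ⟨j, b⟩ hji.le
      rw [if_neg (fun hst => hji.ne (congrArg Sigma.fst hst).symm)] at h1
      simp [h1]
    · intro i a b
      have h1 := hentry ⟨i, a⟩ ⟨i, b⟩ le_rfl
      simp [h1]
    · intro i j a b _
      exact ⟨_, rfl⟩
    · intro i a c
      exact ⟨_, rfl⟩
  · rw [map_funCongrLeft_frameCode, ← hcode, frameCode, frameCode]
    congr 1
    rw [← e.surjective.range_comp]
    congr 1
    funext s
    funext j
    simp [hke]

end StandardForm

section BlockIndex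

variable {R F : Type*} [CommRing R] [Field F] {u : R} {π : R →+* F}

theorem rowDegree_finSigmaFinEquiv (l₁ l₂ l₃ : ℕ) (s : Σ i : Fin 3, Fin (![l₁, l₂, l₃] i)) :
    rowDegree l₁ l₂ (finSigmaFinEquiv s) = s.1 := by
  rcases s with ⟨i, a⟩
  fin_cases i
  · have ha : (a : ℕ) < l₁ := a.2
    simp [finSigmaFinEquiv_apply, rowDegree, ha]
  · have ha : (a : ℕ) < l₂ := a.2
    simp [finSigmaFinEquiv_apply, rowDegree, ha, Fin.castLE]
  · simp [finSigmaFinEquiv_apply, rowDegree, Fin.sum_univ_two, Fin.castLE]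
    omega

/-- A code has type `{l₁, l₂, l₃}` exactly when it has a frame with these multiplicities. -/
theorem IsResidueMap.hasType_iff (h : IsResidueMap u π) [Finite R] {l₁ l₂ l₃ n : ℕ}
    (hn : l₁ + l₂ + l₃ ≤ n) (C : Submodule R (Fin n → R)) :
    HasType u ![l₁, l₂, l₃] C ↔
      ∃ x : Fin (l₁ + l₂ + l₃) → Fin n → R, (LinearIndependent F fun s => π ∘ x s) ∧
        frameCode u (fun s : Fin (l₁ + l₂ + l₃) => rowDegree l₁ l₂ s) x = C := by
  have hsum : ∑ i, ![l₁, l₂, l₃] i = l₁ + l₂ + l₃ := by simp [Fin.sum_univ_three]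
  rw [← hsum]
  rw [← hsum] at hn
  constructor
  · intro hC
    obtain ⟨x, hx, rfl⟩ := exists_frame_of_hasType π hC
    refine ⟨x ∘ finSigmaFinEquiv.symm, hx.comp _ finSigmaFinEquiv.symm.injective, ?_⟩
    rw [frameCode, frameCode, ← finSigmaFinEquiv.surjective.range_comp]
    congr 2
    funext s
    simp only [Function.comp_apply, Equiv.symm_apply_apply, rowDegree_finSigmaFinEquiv]
  · rintro ⟨x, hx, rfl⟩
    exact h.hasType_of_frame finSigmaFinEquiv hn
      (fun s t hst => rowDegree_mono l₁ l₂ hst) (rowDegree_finSigmaFinEquiv l₁ l₂ l₃) hx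

end BlockIndex

/-! ### Counting frames of self-orthogonal codes -/

section SelfOrthogonalFrames

variable {R F : Type*} [CommRing R] [Field F] {u : R} {π : R →+* F} {ι : Type*} [Fintype ι]

theorem isSelfOrthogonal_frameCode_iff {S : Type*} {k : S → ℕ} {x : S → ι → R} :
    IsSelfOrthogonal (frameCode u k x) ↔ ∀ s t, u ^ (k s + k t) * (x s ⬝ᵥ x t) = 0 := by
  have hdot : ∀ s t, (u ^ k s • x s) ⬝ᵥ (u ^ k t • x t) = u ^ (k s + k t) * (x s ⬝ᵥ x t) := by
    intro s t
    rw [smul_dotProduct, dotProduct_smul, smul_smul, ← pow_add, smul_eq_mul]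
  constructor
  · intro hC s t
    rw [← hdot]
    exact hC (pow_smul_mem_frameCode u k x t) _ (pow_smul_mem_frameCode u k x s)
  · intro hx
    refine Submodule.span_le.2 ?_
    rintro _ ⟨t, rfl⟩ v hv
    induction hv using Submodule.span_induction with
    | mem v hv =>
      obtain ⟨s, rfl⟩ := hv
      exact (hdot s t).trans (hx s t)
    | zero => exact zero_dotProduct _
    | add v w _ _ hv hw => rw [add_dotProduct, hv, hw, add_zero]
    | smul c v _ hv => rw [smul_dotProduct, hv, smul_zero]

theorem exists_sum_sq_eq {R : Type*} [CommRing R] (v : ι → R) :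
    ∃ y, (1 ⬝ᵥ v) ^ 2 = v ⬝ᵥ v + 2 * y := by
  classical
  rw [one_dotProduct]
  simp only [dotProduct]
  induction (Finset.univ : Finset ι) using Finset.induction_on with
  | empty => exact ⟨0, by simp⟩
  | insert i s hi ih =>
    obtain ⟨y, hy⟩ := ih
    refine ⟨y + v i * ∑ j ∈ s, v j, ?_⟩
    rw [Finset.sum_insert hi, Finset.sum_insert hi]
    linear_combination hy

theorem map_dotProduct (π : R →+* F) (v w : ι → R) : π (v ⬝ᵥ w) = (π ∘ v) ⬝ᵥ (π ∘ w) := by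
  simp [dotProduct]

theorem dotProduct_digits (a b c a' b' c' : ι → R) (u : R) (hu : u ^ 3 = 0) :
    (a + u • b + u ^ 2 • c) ⬝ᵥ (a' + u • b' + u ^ 2 • c') =
      a ⬝ᵥ a' + u * (a ⬝ᵥ b' + b ⬝ᵥ a') + u ^ 2 * (b ⬝ᵥ b' + a ⬝ᵥ c' + c ⬝ᵥ a') := by
  simp only [add_dotProduct, dotProduct_add, smul_dotProduct, dotProduct_smul, smul_eq_mul]
  linear_combination (b ⬝ᵥ c' + c ⬝ᵥ b' + u * (c ⬝ᵥ c')) * hu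

namespace IsResidueMap

/-- The norm of a vector whose residue is isotropic is divisible by `u ^ 2` and not only by `u`,
since it is congruent to the square of the sum of the coordinates modulo `2`. -/
theorem sq_dvd_dotProduct_self (h : IsResidueMap u π) {v : ι → R}
    (hv : (π ∘ v) ⬝ᵥ (π ∘ v) = 0) : u ^ 2 ∣ v ⬝ᵥ v := by
  have hchar := h.charP
  rw [dotProduct_self_eq_sq, pow_eq_zero_iff two_ne_zero] at hv
  have h1 : π (1 ⬝ᵥ v) = 0 := by
    rw [map_dotProduct, ← hv]
    congr 1
    ext i
    simp
  obtain ⟨z, hz⟩ := (h.eq_zero_iff _).1 h1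
  obtain ⟨y, hy⟩ := exists_sum_sq_eq v
  have h2 : v ⬝ᵥ v = u ^ 2 * z ^ 2 - 2 * y := by
    rw [hz] at hy
    linear_combination - hy
  rw [h2]
  exact dvd_sub (dvd_mul_right _ _) (h.sq_dvd_two.mul_right y)

/-- For a fixed residue tuple `a`, the orthogonality relations of a tuple with digits `a`, `b`, `c`
form an inhomogeneous linear system for `b`, and, once `b` is given, another one for `c`. The
relations `x s ⬝ᵥ x s = 0` reduce to `(1 ⬝ᵥ b s) ^ 2 = r` for some constant `r`, which is a linear
equation because every element of `F` has a unique square root. -/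
theorem exists_linear_systems (h : IsResidueMap u π) [Finite F] {N : ℕ} {k : Fin N → ℕ}
    {a : Fin N → ι → F} (ha : ∀ s t, k s + k t ≤ 2 → a s ⬝ᵥ a t = 0) :
    ∃ (β : Fin N × Fin N → F) (γ : (Fin N → ι → F) → Fin N × Fin N → F),
      ∀ b c : Fin N → ι → F,
        (∀ s t, u ^ (k s + k t) *
          ((h.lift ∘ a s + u • h.lift ∘ b s + u ^ 2 • h.lift ∘ c s) ⬝ᵥ
            (h.lift ∘ a t + u • h.lift ∘ b t + u ^ 2 • h.lift ∘ c t)) = 0) ↔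
        (∀ p : Fin N × Fin N, p.1 ≤ p.2 → k p.1 + k p.2 ≤ 1 → pairFunctional a p b = β p) ∧
        (∀ p : Fin N × Fin N, p.1 < p.2 → k p.1 + k p.2 = 0 →
          pairFunctional a p c = γ b p) := by
  have hchar := h.charP
  have hlift : ∀ v : ι → F, π ∘ (h.lift ∘ v) = v := fun v => by ext; simp
  have he : ∀ s t, ∃ e, k s + k t ≤ 2 → (h.lift ∘ a s) ⬝ᵥ (h.lift ∘ a t) = u * e := by
    intro s t
    by_cases hst : k s + k t ≤ 2
    · have h1 : π ((h.lift ∘ a s) ⬝ᵥ (h.lift ∘ a t)) = 0 := by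
        rw [map_dotProduct, hlift, hlift, ha s t hst]
      obtain ⟨e, he⟩ := (h.eq_zero_iff _).1 h1
      exact ⟨e, fun _ => he⟩
    · exact ⟨0, fun hst' => absurd hst' hst⟩
  choose e he using he
  have hg : ∀ s, ∃ g, k s = 0 → (h.lift ∘ a s) ⬝ᵥ (h.lift ∘ a s) = u ^ 2 * g := by
    intro s
    by_cases hs : k s = 0
    · obtain ⟨g, hg⟩ := h.sq_dvd_dotProduct_self (v := h.lift ∘ a s)
        (by rw [hlift]; exact ha s s (by omega))
      exact ⟨g, fun _ => hg⟩
    · exact ⟨0, fun hs' => absurd hs' hs⟩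
  choose g hg using hg
  have hsqrt : ∀ r : F, ∃ z : F, z ^ 2 = -r := by
    have hinj : Function.Injective fun z : F => z ^ 2 := fun z w hzw =>
      CharTwo.sq_injective hzw
    exact fun r => (Finite.injective_iff_surjective.1 hinj) (-r)
  choose sq hsq using hsqrt
  have hf : ∀ (b : Fin N → ι → F) s t, ∃ f,
      π (e s t) + (a s ⬝ᵥ b t + b s ⬝ᵥ a t) = 0 →
      e s t + ((h.lift ∘ a s) ⬝ᵥ (h.lift ∘ b t) + (h.lift ∘ b s) ⬝ᵥ (h.lift ∘ a t)) = u * f := by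
    intro b s t
    by_cases hb : π (e s t) + (a s ⬝ᵥ b t + b s ⬝ᵥ a t) = 0
    · have h1 : π (e s t +
          ((h.lift ∘ a s) ⬝ᵥ (h.lift ∘ b t) + (h.lift ∘ b s) ⬝ᵥ (h.lift ∘ a t))) = 0 := by
        rw [map_add, map_add, map_dotProduct, map_dotProduct, hlift, hlift, hlift, hlift, hb]
      obtain ⟨f, hf⟩ := (h.eq_zero_iff _).1 h1
      exact ⟨f, fun _ => hf⟩
    · exact ⟨0, fun hb' => absurd hb' hb⟩
  choose f hf using hf
  refine ⟨fun p => if p.1 = p.2 then sq (π (g p.1)) else -π (e p.1 p.2),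
    fun b p => -(π (f b p.1 p.2) + b p.1 ⬝ᵥ b p.2), fun b c => ?_⟩
  -- The three kinds of relations, according to the exponent of `u`.
  have hdiag : ∀ s, k s = 0 →
      ((h.lift ∘ a s + u • h.lift ∘ b s + u ^ 2 • h.lift ∘ c s) ⬝ᵥ
        (h.lift ∘ a s + u • h.lift ∘ b s + u ^ 2 • h.lift ∘ c s) = 0 ↔
        1 ⬝ᵥ b s = sq (π (g s))) := by
    intro s hs
    have h2 : (h.lift ∘ a s + u • h.lift ∘ b s + u ^ 2 • h.lift ∘ c s) ⬝ᵥ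
        (h.lift ∘ a s + u • h.lift ∘ b s + u ^ 2 • h.lift ∘ c s) =
        u ^ 2 * (g s + (h.lift ∘ b s) ⬝ᵥ (h.lift ∘ b s)) := by
      rw [dotProduct_digits _ _ _ _ _ _ u h.cube, hg s hs,
        dotProduct_comm (h.lift ∘ b s) (h.lift ∘ a s),
        dotProduct_comm (h.lift ∘ c s) (h.lift ∘ a s)]
      linear_combination h.two_mul_u ((h.lift ∘ a s) ⬝ᵥ (h.lift ∘ b s)) +
        u * h.two_mul_u ((h.lift ∘ a s) ⬝ᵥ (h.lift ∘ c s))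
    rw [h2, h.sq_mul_eq_zero_iff, map_add, map_dotProduct, hlift, dotProduct_self_eq_sq,
      add_eq_zero_iff_eq_neg', ← hsq]
    exact CharTwo.sq_injective.eq_iff
  have hone : ∀ s t, k s + k t ≤ 2 → (u ^ 1 *
      ((h.lift ∘ a s + u • h.lift ∘ b s + u ^ 2 • h.lift ∘ c s) ⬝ᵥ
        (h.lift ∘ a t + u • h.lift ∘ b t + u ^ 2 • h.lift ∘ c t)) = 0 ↔
        π (e s t) + (a s ⬝ᵥ b t + b s ⬝ᵥ a t) = 0) := by
    intro s t hst
    have h2 : u ^ 1 * ((h.lift ∘ a s + u • h.lift ∘ b s + u ^ 2 • h.lift ∘ c s) ⬝ᵥ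
        (h.lift ∘ a t + u • h.lift ∘ b t + u ^ 2 • h.lift ∘ c t)) =
        u ^ 2 * (e s t +
          ((h.lift ∘ a s) ⬝ᵥ (h.lift ∘ b t) + (h.lift ∘ b s) ⬝ᵥ (h.lift ∘ a t))) := by
      rw [dotProduct_digits _ _ _ _ _ _ u h.cube, he s t hst]
      linear_combination ((h.lift ∘ b s) ⬝ᵥ (h.lift ∘ b t) + (h.lift ∘ a s) ⬝ᵥ (h.lift ∘ c t) +
        (h.lift ∘ c s) ⬝ᵥ (h.lift ∘ a t)) * h.cube
    rw [h2, h.sq_mul_eq_zero_iff, map_add, map_add, map_dotProduct, map_dotProduct,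
      hlift, hlift, hlift, hlift]
  have hzero : ∀ s t, k s + k t ≤ 2 → π (e s t) + (a s ⬝ᵥ b t + b s ⬝ᵥ a t) = 0 →
      ((h.lift ∘ a s + u • h.lift ∘ b s + u ^ 2 • h.lift ∘ c s) ⬝ᵥ
        (h.lift ∘ a t + u • h.lift ∘ b t + u ^ 2 • h.lift ∘ c t) = 0 ↔
        a s ⬝ᵥ c t + a t ⬝ᵥ c s = -(π (f b s t) + b s ⬝ᵥ b t)) := by
    intro s t hst hb
    have h2 : (h.lift ∘ a s + u • h.lift ∘ b s + u ^ 2 • h.lift ∘ c s) ⬝ᵥ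
        (h.lift ∘ a t + u • h.lift ∘ b t + u ^ 2 • h.lift ∘ c t) =
        u ^ 2 * (f b s t + ((h.lift ∘ b s) ⬝ᵥ (h.lift ∘ b t) +
          (h.lift ∘ a s) ⬝ᵥ (h.lift ∘ c t) + (h.lift ∘ c s) ⬝ᵥ (h.lift ∘ a t))) := by
      rw [dotProduct_digits _ _ _ _ _ _ u h.cube, he s t hst]
      linear_combination u * hf b s t hb
    rw [h2, h.sq_mul_eq_zero_iff, map_add, map_add, map_add, map_dotProduct, map_dotProduct,
      map_dotProduct, hlift, hlift, hlift, hlift, hlift, hlift, dotProduct_comm (c s),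
      eq_neg_iff_add_eq_zero]
    constructor <;> intro h3 <;> linear_combination h3
  have hpair : ∀ s t, s ≠ t → (pairFunctional a (s, t) b = -π (e s t) ↔
      π (e s t) + (a s ⬝ᵥ b t + b s ⬝ᵥ a t) = 0) := by
    intro s t hst
    rw [pairFunctional_of_ne a hst, eq_neg_iff_add_eq_zero, dotProduct_comm (b s), add_comm]
  constructor
  · intro hx
    have hb : ∀ s t, k s + k t ≤ 1 → π (e s t) + (a s ⬝ᵥ b t + b s ⬝ᵥ a t) = 0 := by
      intro s t hst
      rw [← hone s t (by omega), ← Nat.sub_add_cancel hst, pow_add, mul_assoc, hx, mul_zero]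
    constructor
    · rintro ⟨s, t⟩ hle hst
      by_cases hne : s = t
      · subst hne
        have hs : k s = 0 := by simp only at hst; omega
        rw [pairFunctional_self]
        simp only [if_true]
        have h1 := hx s s
        rw [hs, pow_zero, one_mul] at h1
        exact (hdiag s hs).1 h1
      · simp only [hne, if_false]
        exact (hpair s t hne).2 (hb s t hst)
    · rintro ⟨s, t⟩ hlt hst
      simp only at hst hlt ⊢
      rw [pairFunctional_of_ne a hlt.ne, ← hzero s t (by omega) (hb s t (by omega))]
      have h1 := hx s t
      rwa [hst, pow_zero, one_mul] at h1
  · rintro ⟨hb, hc⟩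
    have key : ∀ s t, s ≤ t → u ^ (k s + k t) *
        ((h.lift ∘ a s + u • h.lift ∘ b s + u ^ 2 • h.lift ∘ c s) ⬝ᵥ
          (h.lift ∘ a t + u • h.lift ∘ b t + u ^ 2 • h.lift ∘ c t)) = 0 := by
      intro s t hle
      rcases lt_or_ge 2 (k s + k t) with h2 | h2
      · rw [← Nat.sub_add_cancel h2, pow_add, h.cube, mul_zero, zero_mul]
      rcases lt_or_ge 1 (k s + k t) with h1 | h1
      · rw [show k s + k t = 2 by omega, h.sq_mul_eq_zero_iff,
          dotProduct_digits _ _ _ _ _ _ u h.cube, he s t h2]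
        simp [h.map_u]
      have h3 := hb (s, t) hle h1
      by_cases hne : s = t
      · subst hne
        have hs : k s = 0 := by omega
        rw [pairFunctional_self] at h3
        simp only [if_true] at h3
        rw [(hdiag s hs).2 h3, mul_zero]
      · simp only [hne, if_false] at h3
        rw [hpair s t hne] at h3
        rcases Nat.eq_zero_or_pos (k s + k t) with h0 | h0
        · have h4 := hc (s, t) (lt_of_le_of_ne hle hne) h0
          rw [pairFunctional_of_ne a hne] at h4
          rw [(hzero s t h2 h3).2 h4, mul_zero]
        · rw [show k s + k t = 1 by omega, hone s t h2]
          exact h3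
    intro s t
    rcases le_total s t with hle | hle
    · exact key s t hle
    · rw [add_comm, dotProduct_comm]; exact key t s hle

end IsResidueMap

theorem card_sigma_mul {I : Type*} {Y : I → Type*} [Finite I] [∀ i, Finite (Y i)] {A B : ℕ}
    (hY : ∀ i, Nat.card (Y i) * A = B) : Nat.card (Σ i, Y i) * A = Nat.card I * B := by
  have : Fintype I := Fintype.ofFinite I
  rw [Nat.card_sigma, Finset.sum_mul]
  simp [hY]

theorem IsResidueMap.card_selfOrthogonal_frames (h : IsResidueMap u π) [Finite R] [Nonempty ι]
    {N : ℕ} (k : Fin N → ℕ) :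
    Nat.card {x : Fin N → ι → R // (LinearIndependent F fun s => π ∘ x s) ∧
        ∀ s t, u ^ (k s + k t) * (x s ⬝ᵥ x t) = 0} *
      Nat.card F ^ (Nat.card {p : Fin N × Fin N // p.1 ≤ p.2 ∧ k p.1 + k p.2 ≤ 1} +
        Nat.card {p : Fin N × Fin N // p.1 < p.2 ∧ k p.1 + k p.2 = 0}) =
    Nat.card {a : Fin N → ι → F // LinearIndependent F a ∧
        ∀ s t, k s + k t ≤ 2 → a s ⬝ᵥ a t = 0} *
      Nat.card F ^ (2 * (N * Fintype.card ι)) := by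
  classical
  have hF : Finite F := Finite.of_surjective π h.surjective
  have hV : Nat.card (Fin N → ι → F) = Nat.card F ^ (N * Fintype.card ι) := by
    rw [Nat.card_fun, Nat.card_fun, ← pow_mul, Nat.card_eq_fintype_card (α := ι), Nat.card_fin,
      mul_comm]
  choose β γ hβγ using fun a : {a : Fin N → ι → F // LinearIndependent F a ∧
    ∀ s t, k s + k t ≤ 2 → a s ⬝ᵥ a t = 0} => h.exists_linear_systems a.2.2
  let vec : (Fin N → ι → F) → (Fin N → ι → F) → (Fin N → ι → F) → Fin N → ι → R :=
    fun a b c s => h.lift ∘ a s + u • h.lift ∘ b s + u ^ 2 • h.lift ∘ c s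
  have hres : ∀ a b c s, π ∘ vec a b c s = a s := by
    intro a b c s
    ext i
    simp [vec, h.map_u]
  have hinj : ∀ a b c a' b' c', vec a b c = vec a' b' c' → a = a' ∧ b = b' ∧ c = c' := by
    intro a b c a' b' c' hv
    have h1 : ∀ s i, (a s i, b s i, c s i) = (a' s i, b' s i, c' s i) := fun s i =>
      h.ofDigits_bijective.1 (congrFun (congrFun hv s) i)
    simp only [Prod.mk.injEq] at h1
    exact ⟨funext₂ fun s i => (h1 s i).1, funext₂ fun s i => (h1 s i).2.1,
      funext₂ fun s i => (h1 s i).2.2⟩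
  have hsurj : ∀ x : Fin N → ι → R, ∃ a b c, vec a b c = x := by
    intro x
    choose d hd using fun s i => h.ofDigits_bijective.2 (x s i)
    exact ⟨fun s i => (d s i).1, fun s i => (d s i).2.1, fun s i => (d s i).2.2,
      funext₂ fun s i => hd s i⟩
  let Pb := {p : Fin N × Fin N // p.1 ≤ p.2 ∧ k p.1 + k p.2 ≤ 1}
  let Pc := {p : Fin N × Fin N // p.1 < p.2 ∧ k p.1 + k p.2 = 0}
  let A := {a : Fin N → ι → F // LinearIndependent F a ∧
    ∀ s t, k s + k t ≤ 2 → a s ⬝ᵥ a t = 0}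
  let B : A → Type _ := fun a => {b // ∀ p : Pb, pairFunctional a.1 p.1 b = β a p.1}
  let D : (Σ a : A, B a) → Type _ :=
    fun q => {c // ∀ p : Pc, pairFunctional q.1.1 p.1 c = γ q.1 q.2.1 p.1}
  have hB : ∀ a : A, Nat.card (B a) * Nat.card F ^ Nat.card Pb =
      Nat.card F ^ (N * Fintype.card ι) := by
    intro a
    rw [← hV, Nat.card_eq_fintype_card (α := Pb)]
    exact card_solutions_mul (fun p : Pb => pairFunctional a.1 p.1)
      ((linearIndependent_pairFunctional a.2.1).comp (fun p : Pb => ⟨p.1, p.2.1⟩)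
        fun p q hpq => Subtype.ext (congrArg (fun z => z.1) hpq)) _
  have hD : ∀ q : (Σ a : A, B a), Nat.card (D q) * Nat.card F ^ Nat.card Pc =
      Nat.card F ^ (N * Fintype.card ι) := by
    intro q
    rw [← hV, Nat.card_eq_fintype_card (α := Pc)]
    exact card_solutions_mul (fun p : Pc => pairFunctional q.1.1 p.1)
      ((linearIndependent_pairFunctional q.1.2.1).comp (fun p : Pc => ⟨p.1, p.2.1.le⟩)
        fun p q hpq => Subtype.ext (congrArg (fun z => z.1) hpq)) _
  have hcong : Nat.card (Σ q : (Σ a : A, B a), D q) =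
      Nat.card {x : Fin N → ι → R // (LinearIndependent F fun s => π ∘ x s) ∧
        ∀ s t, u ^ (k s + k t) * (x s ⬝ᵥ x t) = 0} := by
    refine Nat.card_congr (Equiv.ofBijective
      (fun q => ⟨vec q.1.1.1 q.1.2.1 q.2.1, ?_, ?_⟩) ⟨?_, ?_⟩)
    · simp only [hres]; exact q.1.1.2.1
    · exact (hβγ q.1.1 q.1.2.1 q.2.1).2
        ⟨fun p h1 h2 => q.1.2.2 ⟨p, h1, h2⟩, fun p h1 h2 => q.2.2 ⟨p, h1, h2⟩⟩
    · rintro ⟨⟨⟨a, ha⟩, ⟨b, hb⟩⟩, ⟨c, hc⟩⟩ ⟨⟨⟨a', ha'⟩, ⟨b', hb'⟩⟩, ⟨c', hc'⟩⟩ hq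
      obtain ⟨rfl, rfl, rfl⟩ := hinj _ _ _ _ _ _ (congrArg Subtype.val hq)
      rfl
    · rintro ⟨x, hx, hxo⟩
      obtain ⟨a, b, c, rfl⟩ := hsurj x
      simp only [hres] at hx
      have ha : ∀ s t, k s + k t ≤ 2 → a s ⬝ᵥ a t = 0 := by
        intro s t hst
        have h1 : u ^ 2 * (vec a b c s ⬝ᵥ vec a b c t) = 0 := by
          rw [← Nat.sub_add_cancel hst, pow_add, mul_assoc, hxo, mul_zero]
        rw [h.sq_mul_eq_zero_iff, map_dotProduct, hres, hres] at h1
        exact h1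
      obtain ⟨h1, h2⟩ := (hβγ ⟨a, hx, ha⟩ b c).1 hxo
      exact ⟨⟨⟨⟨a, hx, ha⟩, ⟨b, fun p => h1 p.1 p.2.1 p.2.2⟩⟩,
        ⟨c, fun p => h2 p.1 p.2.1 p.2.2⟩⟩, rfl⟩
  have h1 := card_sigma_mul hD
  have h2 := card_sigma_mul hB
  rw [hcong] at h1
  calc _ = Nat.card {x : Fin N → ι → R // (LinearIndependent F fun s => π ∘ x s) ∧
        ∀ s t, u ^ (k s + k t) * (x s ⬝ᵥ x t) = 0} * Nat.card F ^ Nat.card Pc *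
        Nat.card F ^ Nat.card Pb := by rw [pow_add]; ring
    _ = Nat.card A * Nat.card F ^ (N * Fintype.card ι) * Nat.card F ^ (N * Fintype.card ι) := by
      rw [h1, ← h2]; ring
    _ = _ := by rw [two_mul, pow_add, mul_assoc]

end SelfOrthogonalFrames

section PairCounting

/-- Swapping the pairs counted second identifies the two families of pairs with all pairs `(s, t)`
such that `s < l₁` and `t < l₁ + l₂`. -/
theorem card_pairs_add_card_pairs (l₁ l₂ l₃ : ℕ) :
    Nat.card {p : Fin (l₁ + l₂ + l₃) × Fin (l₁ + l₂ + l₃) // p.1 ≤ p.2 ∧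
        rowDegree l₁ l₂ p.1 + rowDegree l₁ l₂ p.2 ≤ 1} +
      Nat.card {p : Fin (l₁ + l₂ + l₃) × Fin (l₁ + l₂ + l₃) // p.1 < p.2 ∧
        rowDegree l₁ l₂ p.1 + rowDegree l₁ l₂ p.2 = 0} = l₁ * (l₁ + l₂) := by
  rw [← Nat.card_sum]
  have h1 : ∀ i, rowDegree l₁ l₂ i = 0 ↔ i < l₁ := fun i => rowDegree_eq_zero_iff
  have h2 : ∀ i, rowDegree l₁ l₂ i ≤ 1 ↔ i < l₁ + l₂ := fun i => rowDegree_le_one_iff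
  have h3 : l₁ * (l₁ + l₂) = Nat.card (Fin l₁ × Fin (l₁ + l₂)) := by simp
  rw [h3]
  refine Nat.card_congr (Equiv.ofBijective
    (Sum.elim (fun p => (⟨p.1.1, ?_⟩, ⟨p.1.2, ?_⟩)) fun p => (⟨p.1.2, ?_⟩, ⟨p.1.1, ?_⟩)) ⟨?_, ?_⟩)
  · have hm := rowDegree_mono l₁ l₂ (show (p.1.1 : ℕ) ≤ p.1.2 from p.2.1)
    have hp := p.2.2
    rw [← h1]; omega
  · have hp := p.2.2
    rw [← h2]; omega
  · have hp := p.2.2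
    rw [← h1]; omega
  · have hp := p.2.2
    rw [← h2]; omega
  · rintro (⟨⟨s, t⟩, hp⟩ | ⟨⟨s, t⟩, hp⟩) (⟨⟨s', t'⟩, hp'⟩ | ⟨⟨s', t'⟩, hp'⟩) heq <;>
      simp [Fin.ext_iff] at heq hp hp' ⊢ <;> omega
  · rintro ⟨s, t⟩
    have hs : (s : ℕ) < l₁ + l₂ + l₃ := by omega
    have ht : (t : ℕ) < l₁ + l₂ + l₃ := by omega
    have hs0 := (h1 s).2 s.2
    rcases le_or_gt (s : ℕ) t with hst | hst
    · have ht1 := (h2 t).2 t.2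
      exact ⟨Sum.inl ⟨(⟨s, hs⟩, ⟨t, ht⟩), hst, by simp only; omega⟩, rfl⟩
    · have ht0 := (h1 t).2 (by omega)
      exact ⟨Sum.inr ⟨(⟨t, ht⟩, ⟨s, hs⟩), hst, by simp only; omega⟩, rfl⟩

end PairCounting

/-! ### The formula -/

section Blocks

theorem prod_rowDegree {M : Type*} [CommMonoid M] (l₁ l₂ l₃ : ℕ) (f : ℕ → ℕ → M) :
    ∏ j ∈ Finset.range (l₁ + l₂ + l₃), f (rowDegree l₁ l₂ j) j =
      (∏ j ∈ Finset.range l₁, f 0 j) * (∏ j ∈ Finset.range l₂, f 1 (l₁ + j)) *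
        ∏ j ∈ Finset.range l₃, f 2 (l₁ + l₂ + j) := by
  rw [Finset.prod_range_add, Finset.prod_range_add]
  congr 1
  · congr 1
    · refine Finset.prod_congr rfl fun j hj => ?_
      rw [rowDegree, if_pos (Finset.mem_range.1 hj)]
    · refine Finset.prod_congr rfl fun j hj => ?_
      have := Finset.mem_range.1 hj
      rw [rowDegree, if_neg (by omega), if_pos (by omega)]
  · refine Finset.prod_congr rfl fun j hj => ?_
    rw [rowDegree, if_neg (by omega), if_neg (by omega)]

theorem prod_fin_rowDegree {M : Type*} [CommMonoid M] (l₁ l₂ l₃ : ℕ) (f : ℕ → M) :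
    ∏ s : Fin (l₁ + l₂ + l₃), f (rowDegree l₁ l₂ s) = f 0 ^ l₁ * f 1 ^ l₂ * f 2 ^ l₃ := by
  rw [Fin.prod_univ_eq_prod_range (fun j => f (rowDegree l₁ l₂ j)),
    prod_rowDegree l₁ l₂ l₃ fun i _ => f i]
  simp

theorem card_rowDegree_le (l₁ l₂ l₃ i : ℕ) :
    Nat.card {t : Fin (l₁ + l₂ + l₃) // rowDegree l₁ l₂ t ≤ i} =
      l₁ + (if 1 ≤ i then l₂ else 0) + if 2 ≤ i then l₃ else 0 := by
  rw [Nat.card_eq_fintype_card, Fintype.card_subtype, Finset.card_filter]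
  have h := prod_fin_rowDegree (M := Multiplicative ℕ) l₁ l₂ l₃
    fun j => Multiplicative.ofAdd (if j ≤ i then 1 else 0)
  have h' := congrArg Multiplicative.toAdd h
  simp only [toAdd_prod, toAdd_mul, toAdd_pow, toAdd_ofAdd, smul_eq_mul, zero_le, if_true, mul_one,
    mul_ite, mul_zero] at h'
  exact h'

end Blocks

section Count

variable {R F : Type*} [CommRing R] [Field F] {u : R} {π : R →+* F}

/-- Counting pairs of a self-orthogonal code of the given type and a frame of it in two ways. -/
theorem IsResidueMap.numSelfOrthogonal_mul (h : IsResidueMap u π) [Finite R] {l₁ l₂ l₃ n : ℕ}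
    (hn : l₁ + l₂ + l₃ ≤ n) {A B : ℚ}
    (hAB : ∀ x₀ : Fin (l₁ + l₂ + l₃) → Fin n → R, (LinearIndependent F fun s => π ∘ x₀ s) →
      (Nat.card {x : Fin (l₁ + l₂ + l₃) → Fin n → R // (LinearIndependent F fun s => π ∘ x s) ∧
        frameCode u (fun s : Fin (l₁ + l₂ + l₃) => rowDegree l₁ l₂ s) x =
          frameCode u (fun s : Fin (l₁ + l₂ + l₃) => rowDegree l₁ l₂ s) x₀} : ℚ) * A = B) :
    (numSelfOrthogonal u n ![l₁, l₂, l₃] : ℚ) * B =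
      Nat.card {x : Fin (l₁ + l₂ + l₃) → Fin n → R // (LinearIndependent F fun s => π ∘ x s) ∧
        ∀ s t : Fin (l₁ + l₂ + l₃),
          u ^ (rowDegree l₁ l₂ s + rowDegree l₁ l₂ t) * (x s ⬝ᵥ x t) = 0} * A := by
  classical
  set k : Fin (l₁ + l₂ + l₃) → ℕ := fun s => rowDegree l₁ l₂ s with hk
  let 𝒞 := {C : Submodule R (Fin n → R) // IsSelfOrthogonal C ∧ HasType u ![l₁, l₂, l₃] C}
  have e : {x : Fin (l₁ + l₂ + l₃) → Fin n → R // (LinearIndependent F fun s => π ∘ x s) ∧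
      ∀ s t, u ^ (k s + k t) * (x s ⬝ᵥ x t) = 0} ≃
      Σ C : 𝒞, {x : Fin (l₁ + l₂ + l₃) → Fin n → R //
        (LinearIndependent F fun s => π ∘ x s) ∧ frameCode u k x = C.1} :=
    { toFun := fun x => ⟨⟨frameCode u k x.1, isSelfOrthogonal_frameCode_iff.2 x.2.2,
        (h.hasType_iff hn _).2 ⟨x.1, x.2.1, rfl⟩⟩, ⟨x.1, x.2.1, rfl⟩⟩
      invFun := fun q => ⟨q.2.1, q.2.2.1, isSelfOrthogonal_frameCode_iff.1 (by
        rw [q.2.2.2]; exact q.1.2.1)⟩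
      left_inv := fun x => rfl
      right_inv := by
        rintro ⟨⟨C, hC⟩, ⟨x, hx, hxC⟩⟩
        obtain rfl : frameCode u k x = C := hxC
        rfl }
  have : Finite (Submodule R (Fin n → R)) := Finite.of_injective _ SetLike.coe_injective
  have : Fintype 𝒞 := Fintype.ofFinite _
  have hfib : ∀ C : 𝒞, (Nat.card {x : Fin (l₁ + l₂ + l₃) → Fin n → R //
      (LinearIndependent F fun s => π ∘ x s) ∧ frameCode u k x = C.1} : ℚ) * A = B := by
    rintro ⟨C, -, hC⟩
    obtain ⟨x₀, hx₀, rfl⟩ := (h.hasType_iff hn _).1 hC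
    exact hAB x₀ hx₀
  have hnum : numSelfOrthogonal u n ![l₁, l₂, l₃] = Fintype.card 𝒞 := by
    rw [numSelfOrthogonal, ← Nat.card_coe_set_eq, ← Nat.card_eq_fintype_card]
    rfl
  rw [Nat.card_congr e, Nat.card_sigma, hnum]
  push_cast
  rw [Finset.sum_mul, Finset.sum_congr rfl fun C _ => hfib C]
  simp

/-- The formula for the number of self-orthogonal codes, with `q` the order of the residue field. -/
theorem IsResidueMap.numSelfOrthogonal_eq (h : IsResidueMap u π) [Finite R]
    (n l₁ l₂ l₃ : ℕ) (hn : 1 ≤ n) (h₂ : 2 * l₁ + 2 * l₂ ≤ n) (h₃ : 2 * l₁ + l₂ + l₃ ≤ n) :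
    (numSelfOrthogonal u n ![l₁, l₂, l₃] : ℚ) =
      sHat (Nat.card F) n (l₁ + l₂) *
        (Nat.card F : ℚ) ^
          (l₃ * l₁ + (l₁ + (l₁ + l₂)) * (n - (l₁ + l₂ + l₃) - l₁) + l₁ ^ 2) *
        gaussBinom (Nat.card F) (l₁ + l₂) l₁ *
        gaussBinom (Nat.card F) (l₃ + (n - (l₁ + l₂ + l₃) - l₁)) l₃ := by
  have hF : Finite F := Finite.of_surjective π h.surjective
  have hchar := h.charP
  have hq : 2 ≤ Nat.card F := Finite.one_lt_card
  have : Nonempty (Fin n) := ⟨⟨0, hn⟩⟩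
  have hX := h.card_selfOrthogonal_frames (ι := Fin n)
    fun s : Fin (l₁ + l₂ + l₃) => rowDegree l₁ l₂ s
  have hA := card_isResidueTuple (F := F) (ι := Fin n) l₁ l₂ l₃
  have hI := card_isIsotropic (F := F) (ι := Fin n) (d := l₁ + l₂) (Fintype.card_fin n) (by omega)
  have hM := h.numSelfOrthogonal_mul (l₁ := l₁) (l₂ := l₂) (l₃ := l₃) (n := n) (by omega)
    fun x₀ hx₀ => h.card_frames (rowDegree_mono l₁ l₂) (rowDegree_le_two l₁ l₂) hx₀
  simp only [IsResidueTuple] at hA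
  simp only [card_pairs_add_card_pairs, Fintype.card_fin] at hX hA hM
  replace hX := congrArg (Nat.cast : ℕ → ℚ) hX
  push_cast at hX hM
  rw [hA, hI] at hX
  clear hA hI
  generalize (Nat.card {x : Fin (l₁ + l₂ + l₃) → Fin n → R //
    (LinearIndependent F fun s => π ∘ x s) ∧
        ∀ s t : Fin (l₁ + l₂ + l₃),
          u ^ (rowDegree l₁ l₂ s + rowDegree l₁ l₂ t) * (x s ⬝ᵥ x t) = 0} : ℚ) =
      X at hX hM
  generalize (numSelfOrthogonal u n ![l₁, l₂, l₃] : ℚ) = M at hM ⊢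
  generalize Nat.card F = q at *
  have hq0 : (q : ℚ) ≠ 0 := by positivity
  generalize sHat q n (l₁ + l₂) = T at *
  -- Evaluate the products over the rows, block by block.
  have hK := prod_fin_rowDegree l₁ l₂ l₃ fun i => (q : ℚ) ^ Nat.card
    {t : Fin (l₁ + l₂ + l₃) // rowDegree l₁ l₂ t ≤ i}
  have hL := prod_fin_rowDegree l₁ l₂ l₃ fun i =>
    (∏ t : Fin (l₁ + l₂ + l₃), (q : ℚ) ^ (3 - max (rowDegree l₁ l₂ t) i)) * (q : ℚ) ^ (i * n)
  have hL' := fun i => prod_fin_rowDegree l₁ l₂ l₃ fun j => (q : ℚ) ^ (3 - max j i)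
  have hP := prod_rowDegree l₁ l₂ l₃ fun i j => (q : ℚ) ^ Nat.card
    {t : Fin (l₁ + l₂ + l₃) // rowDegree l₁ l₂ t ≤ i} - (q : ℚ) ^ j
  rw [hK, hL, hP, hL', hL', hL'] at hM
  simp only [card_rowDegree_le] at hM
  norm_num at hM
  -- The factors counting frames over the residue field.
  obtain ⟨r, rfl⟩ : ∃ r, n = l₁ + l₂ + l₃ + l₁ + r := ⟨n - (l₁ + l₂ + l₃ + l₁), by omega⟩
  have hr : l₁ + l₂ + l₃ + l₁ + r - (l₁ + l₂ + l₃) - l₁ = r := by omega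
  have hr' : l₁ + l₂ + l₃ + l₁ + r - l₁ = l₁ + l₂ + (l₃ + r) := by omega
  rw [hr]
  rw [hr', Finset.prod_range_add] at hX
  have hG₁ := gaussBinom_mul_prod hq (Nat.le_add_right l₁ l₂)
  have hG₂ := gaussBinom_mul_prod hq (Nat.le_add_right l₃ r)
  rw [← hG₁] at hX
  have hshift : ∀ e, ∏ j ∈ Finset.range l₃, ((q : ℚ) ^ (l₁ + l₂ + e) - (q : ℚ) ^ (l₁ + l₂ + j)) =
      ((q : ℚ) ^ (l₁ + l₂)) ^ l₃ * ∏ j ∈ Finset.range l₃, ((q : ℚ) ^ e - (q : ℚ) ^ j) := by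
    intro e
    simp only [pow_add _ (l₁ + l₂), ← mul_sub, Finset.prod_mul_distrib, Finset.prod_const,
      Finset.card_range]
  rw [hshift, ← hG₂] at hX
  rw [hshift] at hM
  have hne : ∀ e d f : ℕ, d + f ≤ e →
      ∏ j ∈ Finset.range d, ((q : ℚ) ^ e - (q : ℚ) ^ (f + j)) ≠ 0 := by
    intro e d f hde
    refine Finset.prod_ne_zero_iff.2 fun j hj => ?_
    have hj' := Finset.mem_range.1 hj
    have hlt : (q : ℚ) ^ (f + j) < (q : ℚ) ^ e :=
      pow_lt_pow_right₀ (by exact_mod_cast hq) (by omega)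
    linarith
  have ha := hne l₁ l₁ 0 (by omega)
  have hb := hne (l₁ + l₂) l₂ l₁ (by omega)
  have hc := hne l₃ l₃ 0 (by omega)
  simp only [zero_add] at ha hc
  clear hK hL hL' hP hG₁ hG₂ hshift hne
  generalize ∏ j ∈ Finset.range l₁, ((q : ℚ) ^ l₁ - (q : ℚ) ^ j) = a at *
  generalize ∏ j ∈ Finset.range l₂, ((q : ℚ) ^ (l₁ + l₂) - (q : ℚ) ^ (l₁ + j)) = b at *
  generalize ∏ j ∈ Finset.range l₃, ((q : ℚ) ^ l₃ - (q : ℚ) ^ j) = c at *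
  generalize gaussBinom q (l₁ + l₂) l₁ = G₁ at *
  generalize gaussBinom q (l₃ + r) l₃ = G₂ at *
  have hfactor : a * b * c * (q : ℚ) ^ (l₁ * (3 * l₁ + 2 * l₂ + l₃) +
      l₂ * (2 * l₁ + 2 * l₂ + l₃ + (l₁ + l₂ + l₃ + l₁ + r)) +
      l₃ * (l₁ + l₂ + l₃ + 2 * (l₁ + l₂ + l₃ + l₁ + r)) + (l₁ + l₂) * l₃ +
      l₁ * (l₁ + l₂)) ≠ 0 :=
    mul_ne_zero (mul_ne_zero (mul_ne_zero ha hb) hc) (pow_ne_zero _ hq0)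
  refine mul_right_cancel₀ hfactor ?_
  linear_combination (q : ℚ) ^ (l₁ * (l₁ + l₂)) * hM +
    ((q : ℚ) ^ l₁) ^ l₁ * ((q : ℚ) ^ (l₁ + l₂)) ^ l₂ * ((q : ℚ) ^ (l₁ + l₂ + l₃)) ^ l₃ * hX

end Count

end LinearCode

theorem theorem4p2 {R : Type*} [CommRing R] (u : R) (m : ℕ) (hR : IsEvenChainRing R 3 m 2 u)
    (n l₁ l₂ l₃ : ℕ) (hn : 1 ≤ n)
    (h₂ : 2 * l₁ + 2 * l₂ ≤ n) (h₃ : 2 * l₁ + l₂ + l₃ ≤ n) :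
    (LinearCode.numSelfOrthogonal u n ![l₁, l₂, l₃] : ℚ) =
      LinearCode.sHat (2 ^ m) n (l₁ + l₂) *
        ((2 : ℚ) ^ m) ^
          (l₃ * l₁ + (l₁ + (l₁ + l₂)) * (n - (l₁ + l₂ + l₃) - l₁) + l₁ ^ 2) *
        LinearCode.gaussBinom (2 ^ m) (l₁ + l₂) l₁ *
        LinearCode.gaussBinom (2 ^ m) (l₃ + (n - (l₁ + l₂ + l₃) - l₁)) l₃ := by
  have := hR.finite
  have := hR.isMaximal
  let _ := Ideal.Quotient.field (Ideal.span {u})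
  have h := hR.isResidueMap.numSelfOrthogonal_eq n l₁ l₂ l₃ hn h₂ h₃
  rw [hR.card_residue] at h
  push_cast at h
  exact h
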